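/- Let $F$ be a real vector space of dimension $l+2$ with a symmetric bilinear form $I$ of signature $(l,2,0)$, i.e. $I$ is positive semi-definite and its radical $\mathrm{rad}(I)$ has dimension $2$. For $I(\alpha,\alpha)\neq 0$ put $\alpha^\vee=\frac{2}{I(\alpha,\alpha)}\alpha$ and $w_\alpha(x)=x-I(x,\alpha^\vee)\alpha$. An *elliptic root system* in $(F,I)$ is a non-empty discrete subset $R\subset F$ such that: the group $Q(R)=\mathbb{Z}R$ is a full lattice in $F$; $I(\alpha,\alpha)\ne 0$ and $w_\alpha(R)=R$ for all $\alpha\in R$; $I(\alpha^\vee,\beta)\in\mathbb{Z}$ for all $\alpha,\beta\in R$; and $R$ is not the union of two non-empty mutually orthogonal subsets. A *marking* of $R$ is a one-dimensional subspace $G\subset \mathrm{rad}(I)$ such that $G\cap Q(R)$ spans $G$; then $(R,G)$ is a *marked elliptic root system*, and $R/G$ denotes the image of $R$ in $F/G$. A set of roots is *reduced* if it contains neither $2\alpha$ nor $\frac12\alpha$ for any of its elements $\alpha$. An *isomorphism* of elliptic root systems $R\subset (F,I)$, $R'\subset(F',I')$ is a linear isomorphism $\varphi:F\to F'$ with $\varphi(R)=R'$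 that carries $I$ to $I'$ up to a positive scalar; for marked ones, also $\varphi(G)=G'$. Let $\mathbb{R}^{l+2}$ have basis $\varepsilon_1,\dots,\varepsilon_l,a,b$ and the form with $I(\varepsilon_i,\varepsilon_j)=\delta_{ij}$ and radical $\mathbb{R}a\oplus\mathbb{R}b$. Put $B_s=\{\pm\varepsilon_i\}$, $B_m=\{\pm(\varepsilon_i\pm\varepsilon_j): i<j\}$, $B_l=\{\pm2\varepsilon_i\}$, $L_{1,1}=\{ma+nb: m,n\in\mathbb{Z},\ (m-1)(n-1)\equiv 0 \bmod 2\}$, and define the following subsets of $\mathbb{R}^{l+2}$, each marked by $\mathbb{R}a$: \begin{align*} BC_l^{(1,2)}&=(B_s+\mathbb{Z}a+\mathbb{Z}b)\cup(B_m+\mathbb{Z}a+\mathbb{Z}b)\cup(B_l+(1+2\mathbb{Z})a+\mathbb{Z}b),\\ BC_l^{(4,2)}&=(B_s+\mathbb{Z}a+\mathbb{Z}b)\cup(B_m+\mathbb{Z}a+2\mathbb{Z}b)\cup(B_l+(1+2\mathbb{Z})a+4\mathbb{Z}b),\\ BC_l^{(2,2)\sigma}(1)&=(B_s+\mathbb{Z}a+\mathbb{Z}b)\cup(B_m+\mathbb{Z}a+\mathbb{Z}b)\cup(B_l+(1+2\mathbb{Z})a+2\mathbb{Z}b),\\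 BC_l^{(2,2)\sigma}(2)&=(B_s+\mathbb{Z}a+\mathbb{Z}b)\cup(B_m+\mathbb{Z}a+2\mathbb{Z}b)\cup(B_l+(1+2\mathbb{Z})a+2\mathbb{Z}b),\\ BC_l^{(1,1)\ast}&=(B_s+\mathbb{Z}a+\mathbb{Z}b)\cup(B_m+\mathbb{Z}a+\mathbb{Z}b)\cup(B_l+L_{1,1}),\\ BC_l^{(4,4)\ast}&=(B_s+L_{1,1})\cup(B_m+2\mathbb{Z}a+2\mathbb{Z}b)\cup(B_l+4\mathbb{Z}a+4\mathbb{Z}b). \end{align*} **Theorem.** Let $R$ be a reduced elliptic root system in a space with form of signature $(l,2,0)$. (1) If $G$ is a marking of $R$ such that $R/G$ is non-reduced, then $(R,G)$ is isomorphic, as a marked elliptic root system, to one of $BC_l^{(1,2)}$, $BC_l^{(1,1)\ast}$, $BC_l^{(4,2)}$, $BC_l^{(4,4)\ast}$, $BC_l^{(2,2)\sigma}(2)$ ($l\ge1$), or $BC_l^{(2,2)\sigma}(1)$ ($l\geq2$). (2) Either $R$ has a marking $G$ with $R/G$ reduced (so that $R$ occurs in K. Saito's 1985 classification of the marked elliptic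 root systems with reduced quotient), or $R$ is isomorphic to $BC_l^{(1,1)\ast}$ or $BC_l^{(4,4)\ast}$. -/

import Mathlib

open scoped Pointwise

noncomputable section

namespace EllipticRoot

section General

variable {F : Type*} [NormedAddCommGroup F] [NormedSpace ℝ F]

/-- The root lattice `Q(R)`: the additive group spanned by `R`. -/
def rootLattice (R : Set F) : Submodule ℤ F := Submodule.span ℤ R

/-- The coroot `α^∨ = (2 / I(α, α)) α` of a non-isotropic vector `α`. -/
def coroot (I : LinearMap.BilinForm ℝ F) (α : F) : F := (2 / I α α) • α

/-- The reflection `w_α(x) = x - I(x, α^∨) α`. -/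
def reflect (I : LinearMap.BilinForm ℝ F) (α x : F) : F := x - I x (coroot I α) • α

/-- The radical of `I` (for symmetric `I`, the left and right kernels agree). -/
def rad (I : LinearMap.BilinForm ℝ F) : Submodule ℝ F := LinearMap.ker I

/-- Generalized root systems belonging to `(F, I)`. -/
structure IsGeneralizedRootSystem (I : LinearMap.BilinForm ℝ F) (R : Set F) : Prop where
  nonempty : R.Nonempty
  discrete : DiscreteTopology R
  /-- `Q(R)` is a lattice ... -/
  lattice : DiscreteTopology (rootLattice R)
  /-- ... which is full in `F`. -/
  full : Submodule.span ℝ (rootLattice R : Set F) = ⊤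
  nonisotropic : ∀ α ∈ R, I α α ≠ 0
  integral : ∀ α ∈ R, ∀ β ∈ R, ∃ n : ℤ, I (coroot I α) β = n
  reflect_image : ∀ α ∈ R, reflect I α '' R = R
  irreducible : ∀ R₁ R₂ : Set F, R₁ ∪ R₂ = R → (∀ x ∈ R₁, ∀ y ∈ R₂, I x y = 0) →
    R₁ = ∅ ∨ R₂ = ∅

/-- Elliptic root systems of rank `l`: generalized root systems for a symmetric form of signature
`(l, 2, 0)`, i.e. positive semi-definite with two-dimensional radical on a space of dimension
`l + 2`. -/
structure IsElliptic (I : LinearMap.BilinForm ℝ F) (l : ℕ) (R : Set F) : Prop where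
  posSemidef : I.IsPosSemidef
  finrank_space : Module.finrank ℝ F = l + 2
  finrank_rad : Module.finrank ℝ (rad I) = 2
  rootSystem : IsGeneralizedRootSystem I R

/-- A (one-dimensional) marking of `R`: a line `G` in the radical in which `G ∩ Q(R)` is full. -/
structure IsMarking (I : LinearMap.BilinForm ℝ F) (R : Set F) (G : Submodule ℝ F) : Prop where
  le_rad : G ≤ rad I
  finrank_eq : Module.finrank ℝ G = 1
  full : Submodule.span ℝ ((G : Set F) ∩ (rootLattice R : Set F)) = G

/-- `R` is reduced if for any `α ∈ R`, neither `2α` nor `α/2` belongs to `R`. -/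
def IsReduced {V : Type*} [AddCommGroup V] [Module ℝ V] (R : Set V) : Prop :=
  ∀ α ∈ R, (2 : ℝ) • α ∉ R ∧ (1 / 2 : ℝ) • α ∉ R

/-- The quotient root system `R/G`: the image of `R` in `F/G`. -/
def quotientSystem (R : Set F) (G : Submodule ℝ F) : Set (F ⧸ G) := G.mkQ '' R

variable {F' : Type*} [NormedAddCommGroup F'] [NormedSpace ℝ F']

/-- `φ` is an isomorphism of root systems: a linear isomorphism with `φ(R) = R'` which carries one
form to a positive multiple of the other. -/
def IsRootSystemIso (I : LinearMap.BilinForm ℝ F) (R : Set F)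
    (I' : LinearMap.BilinForm ℝ F') (R' : Set F') (φ : F ≃ₗ[ℝ] F') : Prop :=
  φ '' R = R' ∧ ∃ c : ℝ, 0 < c ∧ ∀ x y, I' (φ x) (φ y) = c * I x y

end General

section Models

/-- The space `ℝ^{l+2}`, with coordinates along `ε_1, …, ε_l` and along `a`, `b`. -/
abbrev Space (l : ℕ) : Type := (Fin l → ℝ) × (ℝ × ℝ)

/-- The form of signature `(l, 2, 0)` on `ℝ^{l+2}`: `I(ε_i, ε_j) = δ_{ij}`, radical `ℝa ⊕ ℝb`. -/
def form (l : ℕ) : LinearMap.BilinForm ℝ (Space l) :=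
  (dotProductBilin ℝ ℝ).compl₁₂ (LinearMap.fst ℝ (Fin l → ℝ) (ℝ × ℝ))
    (LinearMap.fst ℝ (Fin l → ℝ) (ℝ × ℝ))

theorem form_apply (l : ℕ) (x y : Space l) : form l x y = ∑ i, x.1 i * y.1 i := rfl

variable (l : ℕ)

def ε (i : Fin l) : Space l := (Pi.single i 1, 0)

def a : Space l := (0, (1, 0))

def b : Space l := (0, (0, 1))

/-- The marking `G = ℝa`. -/
def markingA : Submodule ℝ (Space l) := Submodule.span ℝ {a l}

/-- `R(BC_l)_s = {± ε_i}`. -/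
def bcShort : Set (Space l) := {x | ∃ i, x = ε l i ∨ x = -ε l i}

/-- `R(BC_l)_m = {± (ε_i ± ε_j) | i < j}`. -/
def bcMiddle : Set (Space l) :=
  {x | ∃ i j, i < j ∧ (x = ε l i + ε l j ∨ x = -(ε l i + ε l j) ∨
    x = ε l i - ε l j ∨ x = -(ε l i - ε l j))}

/-- `R(BC_l)_l = {± 2ε_i}`. -/
def bcLong : Set (Space l) := {x | ∃ i, x = (2 : ℝ) • ε l i ∨ x = -((2 : ℝ) • ε l i)}

variable {l} in
/-- The set `kℤv`. -/
def zmul (k : ℤ) (v : Space l) : Set (Space l) := {x | ∃ n : ℤ, x = (k * n) • v}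

/-- The set `(1 + 2ℤ)a`. -/
def oddA : Set (Space l) := {x | ∃ n : ℤ, x = (1 + 2 * n) • a l}

/-- The set `L_{1,1} = {ma + nb | (m - 1)(n - 1) ≡ 0 mod 2}`. -/
def L11 : Set (Space l) :=
  {x | ∃ m n : ℤ, (m - 1) * (n - 1) ≡ 0 [ZMOD 2] ∧ x = m • a l + n • b l}

/-- The four families of non-reduced affine root systems `BCC_l`, `C^∨BC_l`, `BB_l^∨`, `C^∨C_l`. -/
inductive AffineType
  | BCC
  | CveeBC
  | BBvee
  | CveeC

/-- The middle roots of `R(X_l)` are `R(BC_l)_m + kℤb` with this `k`. -/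
def AffineType.middleStep : AffineType → ℤ
  | .BCC => 1
  | .CveeBC => 2
  | .BBvee => 1
  | .CveeC => 2

/-- The long roots of `R(X_l)` are `R(BC_l)_l + kℤb` with this `k`. -/
def AffineType.longStep : AffineType → ℤ
  | .BCC => 1
  | .CveeBC => 4
  | .BBvee => 2
  | .CveeC => 2

/-- `R(X_l)_s`. -/
def affShort (_X : AffineType) : Set (Space l) := bcShort l + zmul 1 (b l)

/-- `R(X_l)_m`. -/
def affMiddle (X : AffineType) : Set (Space l) := bcMiddle l + zmul X.middleStep (b l)

/-- `R(X_l)_l`. -/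
def affLong (X : AffineType) : Set (Space l) := bcLong l + zmul X.longStep (b l)

/-- `(R(X_l)_s + ℤa) ∪ (R(X_l)_m + ℤa) ∪ (R(X_l)_l + (1 + 2ℤ)a)`. -/
def reducedClassical (X : AffineType) : Set (Space l) :=
  (affShort l X + zmul 1 (a l)) ∪ (affMiddle l X + zmul 1 (a l)) ∪ (affLong l X + oddA l)

/-- `BC_l^{(1,2)}`. -/
def BC12 : Set (Space l) := reducedClassical l .BCC

/-- `BC_l^{(4,2)}`. -/
def BC42 : Set (Space l) := reducedClassical l .CveeBC

/-- `BC_l^{(2,2)σ}(1)`. -/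
def BC22σ1 : Set (Space l) := reducedClassical l .BBvee

/-- `BC_l^{(2,2)σ}(2)`. -/
def BC22σ2 : Set (Space l) := reducedClassical l .CveeC

/-- `BC_l^{(1,1)*}`. -/
def BC11star : Set (Space l) :=
  (affShort l .BCC + zmul 1 (a l)) ∪ (affMiddle l .BCC + zmul 1 (a l)) ∪ (bcLong l + L11 l)

/-- `BC_l^{(4,4)*}`. -/
def BC44star : Set (Space l) :=
  (bcShort l + L11 l) ∪ (affMiddle l .CveeBC + zmul 2 (a l)) ∪
    (affLong l .CveeBC + zmul 4 (a l))

end Models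

section Isomorphism

variable {F : Type*} [NormedAddCommGroup F] [NormedSpace ℝ F]

/-- `R` is isomorphic, as a root system, to the subset `T` of the standard space `ℝ^{l+2}`. -/
def IsoTo (I : LinearMap.BilinForm ℝ F) (R : Set F) (l : ℕ) (T : Set (Space l)) : Prop :=
  ∃ φ : F ≃ₗ[ℝ] Space l, IsRootSystemIso I R (form l) T φ

/-- `(R, G)` is isomorphic, as a marked root system, to `(T, ℝa)`. -/
def MarkedIsoTo (I : LinearMap.BilinForm ℝ F) (R : Set F) (G : Submodule ℝ F) (l : ℕ)
    (T : Set (Space l)) : Prop :=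
  ∃ φ : F ≃ₗ[ℝ] Space l, IsRootSystemIso I R (form l) T φ ∧
    G.map (φ : F →ₗ[ℝ] Space l) = markingA l

end Isomorphism

end EllipticRoot

end

/-! A non-reduced quotient supplies roots `α`, `β` with `β - 2α` in the radical. Rescale the form so
that `α` has length one. Integrality against `β` then makes the pairing of `α` with every root an
integer, and Cauchy–Schwarz leaves few possibilities (`pairing_doubled`). By irreducibility, a
maximal orthonormal family of such doubled roots sees every root, modulo the radical, as `±e_i`,
`±e_i ± e_j` or `±2e_i` (`root_form`). The frame can be corrected by radical vectors so that all
`e_i` and `e_i - e_j` are roots (`exists_isBCFrame`). The reflections in these roots permute the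
fibres over the finite system without changing the translations, so `R` is encoded by three subsets
`S`, `M`, `L` of the radical, one for each length (`exists_fibration`).

Let Λ be the lattice generated by `S`, which is the intersection of the root lattice with the
radical. The remaining reflections make `S` and `M` periodic modulo 2Λ and `L` periodic modulo 4Λ,
and reducedness says that `L` avoids the doubles of elements of `S`. In a basis of Λ whose first
vector spans the marking, what is left is a finite problem about residues modulo 2 and 4. Up to
moving the frame by a lattice vector and shearing the second basis vector it has six solutions
(`IsTranslationTriple.normalForm`), which are the six families.

For the second assertion, the radical contains a non-zero lattice vector because an integral matrix
of root pairings is singular, so some marking exists. If its quotient is non-reduced, the first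
assertion applies. In four of the six families the long roots have odd `a`-coordinate, whereas the
double of a short root has an even one; hence `ℝb` is a marking with reduced quotient
(`exists_reduced_marking`). The two starred families remain. -/

noncomputable section

namespace EllipticRoot

variable {F : Type*} [NormedAddCommGroup F] [NormedSpace ℝ F]

/-! ### Semidefinite root systems and doubled roots -/

/-- The scale-invariant part of the axioms of a generalized root system for a positive
semi-definite form, with reflections written without division. -/
structure IsSemidefRootSystem (J : LinearMap.BilinForm ℝ F) (R : Set F) : Prop where
  symm : ∀ x y, J x y = J y x
  nonneg : ∀ x, 0 ≤ J x x
  pos : ∀ α ∈ R, 0 < J α α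
  integral : ∀ α ∈ R, ∀ β ∈ R, ∃ n : ℤ, 2 * J α β = n * J α α
  reflect_mem : ∀ α ∈ R, ∀ β ∈ R, ∀ t : ℝ, 2 * J α β = t * J α α → β - t • α ∈ R
  irreducible : ∀ R₁ R₂ : Set F, R₁ ∪ R₂ = R → (∀ x ∈ R₁, ∀ y ∈ R₂, J x y = 0) →
    R₁ = ∅ ∨ R₂ = ∅

theorem IsElliptic.isSemidefRootSystem {I : LinearMap.BilinForm ℝ F} {l : ℕ} {R : Set F}
    (h : IsElliptic I l R) : IsSemidefRootSystem I R where
  symm x y := by simpa using (h.posSemidef.1.1 x y)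
  nonneg x := h.posSemidef.2.1 x
  pos α hα := lt_of_le_of_ne (h.posSemidef.2.1 α) (h.rootSystem.nonisotropic α hα).symm
  integral α hα β hβ := by
    obtain ⟨n, hn⟩ := h.rootSystem.integral α hα β hβ
    have h0 := h.rootSystem.nonisotropic α hα
    refine ⟨n, ?_⟩
    rw [← hn]
    simp only [coroot, map_smul, LinearMap.smul_apply, smul_eq_mul]
    field_simp
  reflect_mem α hα β hβ t ht := by
    have h0 := h.rootSystem.nonisotropic α hα
    have hs : I β α = I α β := by simpa using (h.posSemidef.1.1 β α)
    have : reflect I α β = β - t • α := by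
      simp only [reflect, coroot, map_smul, smul_eq_mul, hs]
      congr 2
      field_simp
      linarith
    rw [← this, ← h.rootSystem.reflect_image α hα]
    exact ⟨β, hβ, rfl⟩
  irreducible := h.rootSystem.irreducible

namespace IsSemidefRootSystem

variable {J : LinearMap.BilinForm ℝ F} {R : Set F}

theorem smul (h : IsSemidefRootSystem J R) {c : ℝ} (hc : 0 < c) :
    IsSemidefRootSystem (c • J) R where
  symm x y := by simp [h.symm x y]
  nonneg x := by simpa using mul_nonneg hc.le (h.nonneg x)
  pos α hα := by simpa using mul_pos hc (h.pos α hα)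
  integral α hα β hβ := by
    obtain ⟨n, hn⟩ := h.integral α hα β hβ
    refine ⟨n, ?_⟩
    simp only [LinearMap.smul_apply, smul_eq_mul]
    linear_combination c * hn
  reflect_mem α hα β hβ t ht := by
    refine h.reflect_mem α hα β hβ t ?_
    simp only [LinearMap.smul_apply, smul_eq_mul] at ht
    exact mul_left_cancel₀ hc.ne' (by linear_combination ht)
  irreducible R₁ R₂ hR ho := by
    refine h.irreducible R₁ R₂ hR fun x hx y hy => ?_
    have := ho x hx y hy
    simp only [LinearMap.smul_apply, smul_eq_mul, mul_eq_zero] at this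
    exact this.resolve_left hc.ne'

theorem neg_mem (h : IsSemidefRootSystem J R) {α : F} (hα : α ∈ R) : -α ∈ R := by
  have := h.reflect_mem α hα α hα 2 rfl
  convert this using 1
  module

theorem apply_sq_le (h : IsSemidefRootSystem J R) (x y : F) :
    J x y ^ 2 ≤ J x x * J y y :=
  LinearMap.BilinForm.apply_sq_le_of_symm J h.nonneg ⟨fun x y => h.symm x y⟩ x y

theorem mem_rad_of_self (h : IsSemidefRootSystem J R) {x : F} (hx : J x x = 0) : x ∈ rad J := by
  refine LinearMap.mem_ker.2 (LinearMap.ext fun y => ?_)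
  have := h.apply_sq_le x y
  rw [hx, zero_mul] at this
  exact pow_eq_zero_iff two_ne_zero |>.1 (le_antisymm this (sq_nonneg _))

theorem mem_rad_iff {x : F} : x ∈ rad J ↔ ∀ y, J x y = 0 :=
  ⟨fun hx y => by rw [LinearMap.mem_ker.1 hx]; rfl,
    fun hx => LinearMap.mem_ker.2 (LinearMap.ext hx)⟩

theorem rad_right (h : IsSemidefRootSystem J R) {x : F} (hx : x ∈ rad J) (y : F) : J y x = 0 := by
  rw [h.symm, mem_rad_iff.1 hx]

/-- A root of length one whose double is, modulo the radical, also a root. -/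
structure IsDoubled (J : LinearMap.BilinForm ℝ F) (R : Set F) (e : F) : Prop where
  mem : e ∈ R
  unit : J e e = 1
  double : ∃ f ∈ R, f - (2 : ℝ) • e ∈ rad J

theorem pairing_doubled (h : IsSemidefRootSystem J R) {e β : F} (he : IsDoubled J R e)
    (hβ : β ∈ R) :
    J e β = 0 ∨ (∃ σ : ℝ, (σ = 1 ∨ σ = -1) ∧ (β - σ • e ∈ rad J ∨ β - (2 * σ) • e ∈ rad J)) ∨
      (J β β = 2 ∧ (J e β = 1 ∨ J e β = -1)) := by
  obtain ⟨f, hf, hfe⟩ := he.double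
  have hfx : ∀ x, J f x = 2 * J e x := fun x => by
    have := mem_rad_iff.1 hfe x
    simp only [map_sub, map_smul, LinearMap.sub_apply, LinearMap.smul_apply, smul_eq_mul] at this
    linarith
  have hff : J f f = 4 := by rw [hfx, h.symm, hfx, he.unit]; norm_num
  obtain ⟨n, hn⟩ := h.integral f hf β hβ
  obtain ⟨k, hk⟩ := h.integral β hβ e he.mem
  rw [hff, hfx] at hn
  -- Since `f` is `2e` modulo the radical and has norm 4, the pairing of its coroot with `β` is `J e
  -- β` itself.
  have hn : J e β = n := by linarith
  rw [h.symm, hn] at hk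
  have hcs := h.apply_sq_le e β
  have hpos := h.pos β hβ
  have he1 := he.unit
  rw [hn, he1, one_mul] at hcs
  by_cases hn0 : n = 0
  · left; simp [hn, hn0]
  have hk0 : k ≠ 0 := by
    rintro rfl
    apply hn0
    have : (n : ℝ) = 0 := by simpa using hk
    exact_mod_cast this
  have hnk : 0 < n * k := by
    have : (0 : ℝ) < (n * k : ℝ) := by
      have h1 : (k : ℝ) ≠ 0 := by exact_mod_cast hk0
      have : 2 * (n * k : ℝ) = k ^ 2 * J β β := by linear_combination k * hk
      have : 0 < (k : ℝ) ^ 2 * J β β := by positivity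
      linarith
    exact_mod_cast this
  -- Cauchy–Schwarz gives `n² ≤ J β β`; multiplying by `k²` and using `2nk = k² J β β` yields `(nk)²
  -- ≤ 2nk`.
  have hnk2 : n * k ≤ 2 := by
    have h1 : (n * k : ℝ) * (n * k) ≤ 2 * (n * k) := by
      have : 2 * (n * k : ℝ) = k ^ 2 * J β β := by linear_combination k * hk
      nlinarith [sq_nonneg (k : ℝ)]
    have h2 : (n * k) * (n * k) ≤ 2 * (n * k) := by exact_mod_cast h1
    exact le_of_mul_le_mul_right h2 hnk
  have key : (∃ σ : ℝ, (σ = 1 ∨ σ = -1) ∧ ((J e β = σ ∧ J β β = 2) ∨ (J e β = σ ∧ J β β = 1) ∨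
      (J e β = 2 * σ ∧ J β β = 4))) := by
    have hcase : (n = 1 ∧ k = 1) ∨ (n = 1 ∧ k = 2) ∨ (n = 2 ∧ k = 1) ∨
        (n = -1 ∧ k = -1) ∨ (n = -1 ∧ k = -2) ∨ (n = -2 ∧ k = -1) := by
      have hn2 : n ≤ 2 := by
        rcases lt_or_gt_of_ne hk0 with h' | h' <;> nlinarith
      have hn3 : -2 ≤ n := by
        rcases lt_or_gt_of_ne hk0 with h' | h' <;> nlinarith
      interval_cases n <;> omega
    rcases hcase with ⟨rfl, rfl⟩ | ⟨rfl, rfl⟩ | ⟨rfl, rfl⟩ | ⟨rfl, rfl⟩ | ⟨rfl, rfl⟩ | ⟨rfl, rfl⟩ <;>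
      push_cast at hn hk
    · exact ⟨1, Or.inl rfl, Or.inl ⟨hn, by linarith⟩⟩
    · exact ⟨1, Or.inl rfl, Or.inr (Or.inl ⟨hn, by linarith⟩)⟩
    · exact ⟨1, Or.inl rfl, Or.inr (Or.inr ⟨by linarith, by linarith⟩)⟩
    · exact ⟨-1, Or.inr rfl, Or.inl ⟨hn, by linarith⟩⟩
    · exact ⟨-1, Or.inr rfl, Or.inr (Or.inl ⟨hn, by linarith⟩)⟩
    · exact ⟨-1, Or.inr rfl, Or.inr (Or.inr ⟨by linarith, by linarith⟩)⟩
  obtain ⟨σ, hσ, ⟨h1, h2⟩ | ⟨h1, h2⟩ | ⟨h1, h2⟩⟩ := key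
  · exact Or.inr (Or.inr ⟨h2, by rcases hσ with rfl | rfl <;> simp [h1]⟩)
  · refine Or.inr (Or.inl ⟨σ, hσ, Or.inl (h.mem_rad_of_self ?_)⟩)
    simp only [map_sub, map_smul, LinearMap.sub_apply, LinearMap.smul_apply, smul_eq_mul,
      h.symm β e, h1, h2, he1]
    rcases hσ with rfl | rfl <;> norm_num
  · refine Or.inr (Or.inl ⟨σ, hσ, Or.inr (h.mem_rad_of_self ?_)⟩)
    simp only [map_sub, map_smul, LinearMap.sub_apply, LinearMap.smul_apply, smul_eq_mul,
      h.symm β e, h1, h2, he1]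
    rcases hσ with rfl | rfl <;> norm_num

theorem IsDoubled.reflect (h : IsSemidefRootSystem J R) {e β : F} (he : IsDoubled J R e)
    (hβ : β ∈ R) (hββ : J β β = 2) {σ : ℝ} (hσ : σ = 1 ∨ σ = -1) (heβ : J e β = σ) :
    IsDoubled J R (e - σ • β) := by
  obtain ⟨f, hf, hfe⟩ := he.double
  refine ⟨h.reflect_mem β hβ e he.mem σ (by rw [h.symm, heβ, hββ]; ring), ?_,
    f - (2 * σ) • β, h.reflect_mem β hβ f hf (2 * σ) ?_, ?_⟩
  · simp only [map_sub, map_smul, LinearMap.sub_apply, LinearMap.smul_apply, smul_eq_mul,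
      h.symm β e, heβ, hββ, he.unit]
    rcases hσ with rfl | rfl <;> norm_num
  · have := mem_rad_iff.1 hfe β
    simp only [map_sub, map_smul, LinearMap.sub_apply, LinearMap.smul_apply, smul_eq_mul,
      heβ] at this
    rw [h.symm, hββ]
    linarith
  · convert hfe using 1
    module

end IsSemidefRootSystem

/-! ### Maximal orthonormal families of doubled roots -/

/-- The coordinate vectors `±ε_i`. -/
def IsShortVec {k : ℕ} (v : Fin k → ℝ) : Prop :=
  ∃ i, ∃ σ : ℝ, (σ = 1 ∨ σ = -1) ∧ v = Pi.single i σ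

/-- The coordinate vectors `±ε_i ± ε_j`. -/
def IsMiddleVec {k : ℕ} (v : Fin k → ℝ) : Prop :=
  ∃ i j, i ≠ j ∧ ∃ σ τ : ℝ, (σ = 1 ∨ σ = -1) ∧ (τ = 1 ∨ τ = -1) ∧
    v = Pi.single i σ + Pi.single j τ

/-- The coordinate vectors `±2ε_i`. -/
def IsLongVec {k : ℕ} (v : Fin k → ℝ) : Prop :=
  ∃ i, ∃ σ : ℝ, (σ = 1 ∨ σ = -1) ∧ v = Pi.single i (2 * σ)

/-- The vector with coordinates `v` in the family `e`. -/
abbrev comb {k : ℕ} (e : Fin k → F) : (Fin k → ℝ) →ₗ[ℝ] F := Fintype.linearCombination ℝ e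

theorem comb_single {k : ℕ} (e : Fin k → F) (i : Fin k) (c : ℝ) :
    comb e (Pi.single i c) = c • e i := by
  simp [comb, Fintype.linearCombination_apply_single]

namespace IsSemidefRootSystem

variable {J : LinearMap.BilinForm ℝ F} {R : Set F} {k : ℕ}

/-- An orthonormal family for `J`. -/
def IsOrthonormal (J : LinearMap.BilinForm ℝ F) (e : Fin k → F) : Prop :=
  ∀ i j, J (e i) (e j) = if i = j then 1 else 0

theorem IsOrthonormal.apply_comb {e : Fin k → F} (he : IsOrthonormal J e) (i : Fin k)
    (v : Fin k → ℝ) : J (e i) (comb e v) = v i := by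
  simp [comb, Fintype.linearCombination_apply, map_sum, he i]

theorem IsOrthonormal.apply_comb_comb {e : Fin k → F} (he : IsOrthonormal J e)
    (u v : Fin k → ℝ) : J (comb e u) (comb e v) = ∑ i, u i * v i := by
  conv_lhs => rw [comb, Fintype.linearCombination_apply]
  simp only [map_sum, map_smul, LinearMap.sum_apply, LinearMap.smul_apply, smul_eq_mul]
  exact Finset.sum_congr rfl fun i _ => by rw [he.apply_comb]

theorem IsOrthonormal.linearIndependent {e : Fin k → F} (he : IsOrthonormal J e) :
    LinearIndependent ℝ e := by
  rw [Fintype.linearIndependent_iff]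
  intro g hg i
  have := he.apply_comb i g
  rw [← this, comb, Fintype.linearCombination_apply, hg, map_zero]

/-- A maximal orthonormal family of doubled roots. -/
theorem exists_maximal_doubled [FiniteDimensional ℝ F] (h : IsSemidefRootSystem J R) {e : F}
    (he : IsDoubled J R e) :
    ∃ (k : ℕ) (E : Fin k → F), 0 < k ∧ IsOrthonormal J E ∧ (∀ i, IsDoubled J R (E i)) ∧
      ∀ γ, IsDoubled J R γ → ∃ i, J (E i) γ ≠ 0 := by
  let P : ℕ → Prop := fun k => ∃ E : Fin k → F, IsOrthonormal J E ∧ ∀ i, IsDoubled J R (E i)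
  -- Orthonormal families are linearly independent, so their size is bounded and a largest one
  -- exists; a doubled root orthogonal to it could be adjoined.
  have hbd : ∀ k, P k → k ≤ Module.finrank ℝ F := by
    rintro k ⟨E, hE, -⟩
    simpa using hE.linearIndependent.fintype_card_le_finrank
  have h1 : P 1 := ⟨fun _ => e, fun i j => by simp [Subsingleton.elim i j, he.unit], fun _ => he⟩
  classical
  have hfin : 1 ≤ Module.finrank ℝ F := hbd 1 h1
  obtain ⟨E, hE, hd⟩ := Nat.findGreatest_spec (P := P) hfin h1
  have hle := Nat.le_findGreatest (P := P) hfin h1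
  refine ⟨_, E, hle, hE, hd, fun γ hγ => ?_⟩
  by_contra! hcon
  have hP : P (Nat.findGreatest P (Module.finrank ℝ F) + 1) := by
    refine ⟨Fin.cons γ E, fun i j => ?_, fun i => ?_⟩
    · refine Fin.cases ?_ (fun i => ?_) i <;> refine Fin.cases ?_ (fun j => ?_) j
      · simp [hγ.unit]
      · simp [h.symm γ, hcon, (Fin.succ_ne_zero j).symm]
      · simp [hcon]
      · simp [hE i j]
    · refine Fin.cases ?_ (fun i => ?_) i
      · simpa using hγ
      · simpa using hd i
  have := Nat.le_findGreatest (hbd _ hP) hP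
  omega

theorem exists_sub_mem_rad_of_doubled (h : IsSemidefRootSystem J R) {E : Fin k → F}
    (hd : ∀ i, IsDoubled J R (E i))
    (hmax : ∀ γ, IsDoubled J R γ → ∃ i, J (E i) γ ≠ 0) {γ : F} (hγ : IsDoubled J R γ) :
    ∃ j, ∃ τ : ℝ, (τ = 1 ∨ τ = -1) ∧ γ - τ • E j ∈ rad J := by
  obtain ⟨j, hj⟩ := hmax γ hγ
  rcases h.pairing_doubled (hd j) hγ.mem with h0 | ⟨τ, hτ, h1 | h2⟩ | ⟨h2, -⟩
  · exact absurd h0 hj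
  · exact ⟨j, τ, hτ, h1⟩
  · exfalso
    have ha := mem_rad_iff.1 h2 γ
    have hb := mem_rad_iff.1 h2 (E j)
    simp only [map_sub, map_smul, LinearMap.sub_apply, LinearMap.smul_apply, smul_eq_mul,
      hγ.unit, (hd j).unit, h.symm γ (E j)] at ha hb
    rcases hτ with rfl | rfl <;> linarith
  · rw [hγ.unit] at h2
    norm_num at h2

/-- Only roots of norm 2 need an argument: reflecting `E i` in such a `β` gives another doubled
root, which by maximality is some `±E j` modulo the radical, and solving for `β` exhibits it as a
middle vector. -/
theorem root_form_or_orthogonal (h : IsSemidefRootSystem J R) {E : Fin k → F}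
    (hd : ∀ i, IsDoubled J R (E i))
    (hmax : ∀ γ, IsDoubled J R γ → ∃ i, J (E i) γ ≠ 0) {β : F} (hβ : β ∈ R) :
    (∀ i, J (E i) β = 0) ∨
      ∃ v, (IsShortVec v ∨ IsMiddleVec v ∨ IsLongVec v) ∧ β - comb E v ∈ rad J := by
  by_contra! hcon
  obtain ⟨⟨i, hi⟩, hcon⟩ := hcon
  rcases h.pairing_doubled (hd i) hβ with h0 | ⟨σ, hσ, h1 | h2⟩ | ⟨hββ, hiβ⟩
  · exact hi h0
  · exact hcon (Pi.single i σ) (Or.inl ⟨i, σ, hσ, rfl⟩) (by rwa [comb_single])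
  · exact hcon (Pi.single i (2 * σ)) (Or.inr (Or.inr ⟨i, σ, hσ, rfl⟩)) (by rwa [comb_single])
  · obtain ⟨σ, hσ, hiσ⟩ : ∃ σ : ℝ, (σ = 1 ∨ σ = -1) ∧ J (E i) β = σ := ⟨_, hiβ, rfl⟩
    have hσσ : σ * σ = 1 := by rcases hσ with rfl | rfl <;> norm_num
    have hγ := (hd i).reflect h hβ hββ hσ hiσ
    obtain ⟨j, τ, hτ, hj⟩ := h.exists_sub_mem_rad_of_doubled hd hmax hγ
    have hij : i ≠ j := by
      rintro rfl
      have := h.rad_right hj (E i)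
      simp only [map_sub, map_smul, smul_eq_mul, hiσ, (hd i).unit] at this
      rcases hτ with rfl | rfl <;> linarith
    refine hcon (Pi.single i σ + Pi.single j (-(σ * τ))) (Or.inr (Or.inl ⟨i, j, hij, σ, _, hσ, ?_,
      rfl⟩)) ?_
    · rcases hσ with rfl | rfl <;> rcases hτ with rfl | rfl <;> norm_num
    · have := (rad J).smul_mem (-σ) hj
      rw [map_add, comb_single, comb_single]
      convert this using 1
      have : β = (σ * σ) • β := by rw [hσσ, one_smul]
      nth_rw 1 [this]
      module

theorem apply_of_sub_comb_mem (h : IsSemidefRootSystem J R) {E : Fin k → F}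
    (hE : IsOrthonormal J E) {x : F} {v : Fin k → ℝ} (hx : x - comb E v ∈ rad J) (i : Fin k) :
    J (E i) x = v i := by
  have := h.rad_right hx (E i)
  rw [map_sub, hE.apply_comb] at this
  linarith

/-- By irreducibility no root is orthogonal to a maximal orthonormal family of doubled roots. -/
theorem root_form (h : IsSemidefRootSystem J R) {E : Fin k → F} (hk : 0 < k)
    (hd : ∀ i, IsDoubled J R (E i))
    (hmax : ∀ γ, IsDoubled J R γ → ∃ i, J (E i) γ ≠ 0) {β : F} (hβ : β ∈ R) :
    ∃ v, (IsShortVec v ∨ IsMiddleVec v ∨ IsLongVec v) ∧ β - comb E v ∈ rad J := by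
  refine (h.root_form_or_orthogonal hd hmax hβ).resolve_left fun h0 => ?_
  -- The roots of BC form and the roots orthogonal to the family are mutually orthogonal and exhaust
  -- `R`; the first set contains the family itself, so irreducibility empties the second.
  have hU : {x ∈ R | ∃ v, (IsShortVec v ∨ IsMiddleVec v ∨ IsLongVec v) ∧ x - comb E v ∈ rad J} ∪
      {x ∈ R | ∀ i, J (E i) x = 0} = R := by
    ext x
    simp only [Set.mem_union, Set.mem_ofPred_eq]
    constructor
    · rintro (h1 | h1) <;> exact h1.1
    · intro hx
      rcases h.root_form_or_orthogonal hd hmax hx with h1 | h1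
      · exact Or.inr ⟨hx, h1⟩
      · exact Or.inl ⟨hx, h1⟩
  have hO : ∀ x ∈ {x ∈ R | ∃ v, (IsShortVec v ∨ IsMiddleVec v ∨ IsLongVec v) ∧ x - comb E v ∈ rad J},
      ∀ y ∈ {x ∈ R | ∀ i, J (E i) x = 0}, J x y = 0 := by
    rintro x ⟨-, v, -, hv⟩ y ⟨-, hy⟩
    have h1 := mem_rad_iff.1 hv y
    rw [map_sub, LinearMap.sub_apply] at h1
    have h2 : J (comb E v) y = 0 := by
      rw [comb, Fintype.linearCombination_apply]
      simp [hy]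
    linarith
  rcases h.irreducible _ _ hU hO with h1 | h1
  · have : E ⟨0, hk⟩ ∈ (∅ : Set F) := by
      rw [← h1]
      refine ⟨(hd _).mem, Pi.single ⟨0, hk⟩ 1, Or.inl ⟨_, 1, Or.inl rfl, rfl⟩, ?_⟩
      rw [comb_single, one_smul, sub_self]
      exact zero_mem _
    exact this
  · have : β ∈ (∅ : Set F) := by
      rw [← h1]
      exact ⟨hβ, h0⟩
    exact this

/-- Roots congruent to `±E i ± E j` can be reflected to one congruent to `E i - E j`. -/
theorem exists_sub_form (h : IsSemidefRootSystem J R) {E : Fin k → F} (hE : IsOrthonormal J E)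
    (hER : ∀ i, E i ∈ R) {y : F} (hy : y ∈ R) {i j : Fin k} (hij : i ≠ j) {σ τ : ℝ}
    (hσ : σ = 1 ∨ σ = -1) (hτ : τ = 1 ∨ τ = -1) (hyr : y - (σ • E i + τ • E j) ∈ rad J) :
    ∃ z ∈ R, z - (E i - E j) ∈ rad J := by
  -- The reflection in `E i` reverses the sign of the `i`-th coordinate.
  have flip : ∀ (i j : Fin k), i ≠ j → ∀ (σ τ : ℝ) (y : F), y ∈ R →
      y - (σ • E i + τ • E j) ∈ rad J →
      ∃ z ∈ R, z - ((-σ) • E i + τ • E j) ∈ rad J := by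
    intro i j hij σ τ y hy hyr
    refine ⟨y - (2 * σ) • E i, h.reflect_mem _ (hER i) y hy _ ?_, ?_⟩
    · have := h.rad_right hyr (E i)
      simp only [map_sub, map_add, map_smul, smul_eq_mul, hE i i, hE i j, if_neg hij] at this
      rw [hE i i]
      simp only [if_true] at *
      linarith
    · convert hyr using 1
      module
  have flip₂ : ∀ (σ τ : ℝ) (y : F), y ∈ R → y - (σ • E i + τ • E j) ∈ rad J →
      ∃ z ∈ R, z - (σ • E i + (-τ) • E j) ∈ rad J := by
    intro σ τ y hy hyr
    obtain ⟨z, hz, hzr⟩ := flip j i hij.symm τ σ y hy (by rwa [add_comm])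
    exact ⟨z, hz, by rwa [add_comm]⟩
  obtain ⟨y₁, hy₁, hr₁⟩ : ∃ z ∈ R, z - ((1 : ℝ) • E i + τ • E j) ∈ rad J := by
    rcases hσ with rfl | rfl
    · exact ⟨y, hy, hyr⟩
    · simpa using flip i j hij _ _ y hy hyr
  obtain ⟨y₂, hy₂, hr₂⟩ : ∃ z ∈ R, z - ((1 : ℝ) • E i + (-1 : ℝ) • E j) ∈ rad J := by
    rcases hτ with rfl | rfl
    · simpa using flip₂ _ _ y₁ hy₁ hr₁
    · exact ⟨y₁, hy₁, hr₁⟩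
  refine ⟨y₂, hy₂, ?_⟩
  convert hr₂ using 1
  module

/-- By irreducibility every difference of frame vectors is, modulo the radical, a root. -/
theorem exists_star (h : IsSemidefRootSystem J R) {E : Fin k → F} (hE : IsOrthonormal J E)
    (hER : ∀ i, E i ∈ R)
    (hform : ∀ β ∈ R, ∃ v, (IsShortVec v ∨ IsMiddleVec v ∨ IsLongVec v) ∧ β - comb E v ∈ rad J)
    (o j : Fin k) : j = o ∨ ∃ m ∈ R, m - (E o - E j) ∈ rad J := by
  let P : Fin k → Prop := fun j => j = o ∨ ∃ m ∈ R, m - (E o - E j) ∈ rad J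
  change P j
  -- Regard the indices as vertices joined when some root has both in its support. The property `P`
  -- spreads along edges, so if it failed at `j`, sorting roots by whether their support satisfies
  -- `P` would split `R` orthogonally.
  have hstep : ∀ y ∈ R, ∀ i j, J (E i) y ≠ 0 → J (E j) y ≠ 0 → P i → P j := by
    intro y hy i j hi hj hPi
    by_cases hij : i = j
    · rwa [← hij]
    obtain ⟨z, hz, hzr⟩ : ∃ z ∈ R, z - (E i - E j) ∈ rad J := by
      obtain ⟨v, hv, hyv⟩ := hform y hy
      rw [h.apply_of_sub_comb_mem hE hyv] at hi hj
      rcases hv with ⟨p, σ, hσ, rfl⟩ | ⟨p, q, hpq, σ, τ, hσ, hτ, rfl⟩ | ⟨p, σ, hσ, rfl⟩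
      · exfalso
        by_cases hip : i = p
        · exact hj (Pi.single_eq_of_ne (fun hjp => hij (hip.trans hjp.symm)) _)
        · exact hi (Pi.single_eq_of_ne hip _)
      · rw [map_add, comb_single, comb_single] at hyv
        have hi' : i = p ∨ i = q := by
          by_contra! hc
          exact hi (by simp [hc.1, hc.2])
        have hj' : j = p ∨ j = q := by
          by_contra! hc
          exact hj (by simp [hc.1, hc.2])
        rcases hi' with rfl | rfl <;> rcases hj' with rfl | rfl
        · exact absurd rfl hij
        · exact h.exists_sub_form hE hER hy hpq hσ hτ hyv
        · exact h.exists_sub_form hE hER hy hpq.symm hτ hσ (by rwa [add_comm])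
        · exact absurd rfl hij
      · exfalso
        by_cases hip : i = p
        · exact hj (Pi.single_eq_of_ne (fun hjp => hij (hip.trans hjp.symm)) _)
        · exact hi (Pi.single_eq_of_ne hip _)
    rcases hPi with rfl | ⟨m, hm, hmr⟩
    · exact Or.inr ⟨z, hz, hzr⟩
    by_cases hjo : j = o
    · exact Or.inl hjo
    by_cases hio : i = o
    · subst hio
      exact Or.inr ⟨z, hz, hzr⟩
    -- Modulo the radical `m` is `E o - E i` and `z` is `E i - E j`, so they pair to `-1` and the
    -- reflection of `m` in `z` is `m + z`.
    refine Or.inr ⟨m - (-1 : ℝ) • z, h.reflect_mem z hz m hm _ ?_, ?_⟩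
    · have h1 := mem_rad_iff.1 hzr m
      have h2 := mem_rad_iff.1 hzr z
      have h3 := h.rad_right hmr (E i)
      have h4 := h.rad_right hmr (E j)
      have h5 := h.rad_right hzr (E i)
      have h6 := h.rad_right hzr (E j)
      simp only [map_sub, LinearMap.sub_apply, hE _ _, if_neg hij, if_neg (Ne.symm hij),
        if_neg hjo, if_neg hio, if_true] at h1 h2 h3 h4 h5 h6
      linarith
    · convert (rad J).add_mem hmr hzr using 1
      module
  by_contra hPj
  have hU : {x ∈ R | ∀ i, J (E i) x ≠ 0 → P i} ∪
      {x ∈ R | ∀ i, J (E i) x ≠ 0 → ¬ P i} = R := by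
    ext x
    simp only [Set.mem_union, Set.mem_ofPred_eq]
    constructor
    · rintro (h1 | h1) <;> exact h1.1
    · intro hx
      by_cases hc : ∃ i, J (E i) x ≠ 0 ∧ P i
      · obtain ⟨i, hi, hPi⟩ := hc
        exact Or.inl ⟨hx, fun j hj => hstep x hx i j hi hj hPi⟩
      · push Not at hc
        exact Or.inr ⟨hx, hc⟩
  have hO : ∀ x ∈ {x ∈ R | ∀ i, J (E i) x ≠ 0 → P i},
      ∀ y ∈ {x ∈ R | ∀ i, J (E i) x ≠ 0 → ¬ P i}, J x y = 0 := by
    rintro x ⟨hxR, hx⟩ y ⟨hyR, hy⟩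
    obtain ⟨v, -, hv⟩ := hform x hxR
    have h1 := mem_rad_iff.1 hv y
    rw [map_sub, LinearMap.sub_apply] at h1
    have h2 : J (comb E v) y = 0 := by
      rw [comb, Fintype.linearCombination_apply]
      simp only [map_sum, map_smul, LinearMap.sum_apply, LinearMap.smul_apply, smul_eq_mul]
      refine Finset.sum_eq_zero fun i _ => ?_
      by_cases hi : P i
      · rw [mul_eq_zero]
        right
        by_contra hc
        exact hy i hc hi
      · rw [← h.apply_of_sub_comb_mem hE hv i, mul_eq_zero]
        left
        by_contra hc
        exact hi (hx i hc)
    linarith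
  rcases h.irreducible _ _ hU hO with h1 | h1
  · have : E o ∈ (∅ : Set F) := by
      rw [← h1]
      refine ⟨hER o, fun i hi => Or.inl ?_⟩
      by_contra hio
      exact hi (by rw [hE, if_neg hio])
    exact this
  · have : E j ∈ (∅ : Set F) := by
      rw [← h1]
      refine ⟨hER j, fun i hi => ?_⟩
      have : i = j := by
        by_contra hij
        exact hi (by rw [hE, if_neg hij])
      rwa [this]
    exact this

end IsSemidefRootSystem

/-! ### Correcting the frame by radical vectors -/

/-- An orthonormal family of roots exhibiting `R` modulo the radical as a system of type `BC`,
with the short and middle roots `e i`, `e i - e j` lifted to roots. -/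
structure IsBCFrame (J : LinearMap.BilinForm ℝ F) (R : Set F) {k : ℕ} (e : Fin k → F) : Prop where
  orthonormal : IsSemidefRootSystem.IsOrthonormal J e
  short_mem : ∀ i, e i ∈ R
  sub_mem : ∀ i j, i ≠ j → e i - e j ∈ R
  double : ∀ i, ∃ f ∈ R, f - (2 : ℝ) • e i ∈ rad J
  form : ∀ β ∈ R, ∃ v, (IsShortVec v ∨ IsMiddleVec v ∨ IsLongVec v) ∧ β - comb e v ∈ rad J

namespace IsSemidefRootSystem

variable {J : LinearMap.BilinForm ℝ F} {R : Set F} {k : ℕ}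

/-- The vectors `E o - E j` are roots only modulo the radical. Choosing roots `m j` that lift them
and replacing `E j` by `E o - m j` absorbs the radical errors into the frame, so that the
differences become genuine roots. -/
theorem exists_isBCFrame [FiniteDimensional ℝ F] (h : IsSemidefRootSystem J R) {e : F}
    (he : IsDoubled J R e) : ∃ (k : ℕ) (e : Fin k → F), 0 < k ∧ IsBCFrame J R e := by
  obtain ⟨k, E, hk, hE, hd, hmax⟩ := h.exists_maximal_doubled he
  have hER := fun i => (hd i).mem
  have hform := fun β hβ => h.root_form hk hd hmax (β := β) hβ
  let o : Fin k := ⟨0, hk⟩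
  have hstar := h.exists_star hE hER hform o
  have : ∀ j, ∃ x, x - E j ∈ rad J ∧ x ∈ R ∧ (j = o → x = E o) ∧ (j ≠ o → E o - x ∈ R) := by
    intro j
    by_cases hj : j = o
    · subst hj
      exact ⟨E o, by simp, hER o, fun _ => rfl, fun hne => absurd rfl hne⟩
    · obtain ⟨m, hm, hmr⟩ := (hstar j).resolve_left hj
      -- This is the reflection of `E o` in `m`, hence a root congruent to `E j`.
      refine ⟨E o - m, ?_, ?_, fun h' => absurd h' hj, fun _ => by simpa using hm⟩
      · convert (rad J).neg_mem hmr using 1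
        module
      · have := h.reflect_mem m hm (E o) (hER o) 1 ?_
        · simpa using this
        · have h1 := mem_rad_iff.1 hmr m
          have h3 := h.rad_right hmr (E o)
          have h4 := h.rad_right hmr (E j)
          simp only [map_sub, LinearMap.sub_apply, hE _ _, if_neg hj, if_neg (Ne.symm hj),
            if_true, h.symm m] at h1 h3 h4 ⊢
          linarith
  choose e her heR heo hem using this
  have hee : IsOrthonormal J e := by
    intro i j
    have h1 := mem_rad_iff.1 (her i) (e j)
    have h2 := h.rad_right (her j) (E i)
    rw [map_sub, LinearMap.sub_apply] at h1
    rw [map_sub, hE i j] at h2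
    linarith
  refine ⟨k, e, hk, hee, heR, fun i j hij => ?_, fun i => ?_, fun β hβ => ?_⟩
  · by_cases hi : i = o
    · rw [heo i hi]
      exact hem j (fun hj => hij (hi.trans hj.symm))
    by_cases hj : j = o
    · rw [heo j hj, ← neg_sub]
      exact h.neg_mem (hem i hi)
    -- The roots `E o - e i` and `E o - e j` pair to 1, and reflecting the second in the first gives
    -- `e i - e j`.
    · have := h.reflect_mem _ (hem i hi) _ (hem j hj) 1 ?_
      · simpa using this
      · rw [← heo o rfl]
        simp only [map_sub, LinearMap.sub_apply, hee _ _, if_neg hi, if_neg (Ne.symm hi),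
          if_neg (Ne.symm hj), if_neg hij, if_true]
        norm_num
  · obtain ⟨f, hf, hfr⟩ := (hd i).double
    refine ⟨f, hf, ?_⟩
    convert (rad J).sub_mem hfr ((rad J).smul_mem 2 (her i)) using 1
    module
  · obtain ⟨v, hv, hβv⟩ := hform β hβ
    refine ⟨v, hv, ?_⟩
    have hc : comb e v - comb E v ∈ rad J := by
      simp only [comb, Fintype.linearCombination_apply, ← Finset.sum_sub_distrib, ← smul_sub]
      exact (rad J).sum_mem fun i _ => (rad J).smul_mem _ (her i)
    convert (rad J).sub_mem hβv hc using 1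
    module

end IsSemidefRootSystem

/-! ### Fibres over the finite system -/

/-- The fibre of `R` over the vector with coordinates `v` in the family `e`. -/
def fibre (J : LinearMap.BilinForm ℝ F) (R : Set F) {k : ℕ} (e : Fin k → F) (v : Fin k → ℝ) :
    Set F :=
  {r | r ∈ rad J ∧ comb e v + r ∈ R}

namespace IsBCFrame

open IsSemidefRootSystem

variable {J : LinearMap.BilinForm ℝ F} {R : Set F} {k : ℕ} {e : Fin k → F}

theorem sub_comb_mem_rad (hf : IsBCFrame J R e) (h : IsSemidefRootSystem J R)
    (hspan : Submodule.span ℝ R = ⊤) (x : F) : x - comb e (fun i => J (e i) x) ∈ rad J := by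
  have hx : x ∈ Submodule.span ℝ R := hspan ▸ Submodule.mem_top
  induction hx using Submodule.span_induction with
  | mem x hx =>
    obtain ⟨v, -, hv⟩ := hf.form x hx
    have : (fun i => J (e i) x) = v := funext (h.apply_of_sub_comb_mem hf.orthonormal hv)
    rwa [this]
  | zero =>
    have : (fun i => J (e i) 0) = 0 := by ext; simp
    rw [this]
    simp
  | add x y _ _ hx hy =>
    have : (fun i => J (e i) (x + y)) = (fun i => J (e i) x) + fun i => J (e i) y := by
      ext; simp
    rw [this, map_add]
    convert (rad J).add_mem hx hy using 1
    module
  | smul c x _ hx =>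
    have : (fun i => J (e i) (c • x)) = c • (fun i => J (e i) x) := by
      ext; simp
    rw [this, map_smul, ← smul_sub]
    exact (rad J).smul_mem c hx

/-- Pairing with the frame maps `F` onto `ℝ^k` with kernel the radical. This identifies the size of
the frame with the rank `l`. -/
theorem card_add_finrank_rad [FiniteDimensional ℝ F] (hf : IsBCFrame J R e)
    (h : IsSemidefRootSystem J R) (hspan : Submodule.span ℝ R = ⊤) :
    k + Module.finrank ℝ (rad J) = Module.finrank ℝ F := by
  let f : F →ₗ[ℝ] Fin k → ℝ := LinearMap.pi fun i => J (e i)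
  have hker : LinearMap.ker f = rad J := by
    ext x
    rw [LinearMap.mem_ker]
    constructor
    · intro hx
      have h1 := hf.sub_comb_mem_rad h hspan x
      have : (fun i => J (e i) x) = 0 := hx
      rw [this] at h1
      simpa using h1
    · intro hx
      ext i
      exact h.rad_right hx _
  have hrange : LinearMap.range f = ⊤ := by
    rw [LinearMap.range_eq_top]
    intro v
    exact ⟨comb e v, funext fun i => hf.orthonormal.apply_comb i v⟩
  have := LinearMap.finrank_range_add_finrank_ker f
  rw [hker, hrange, finrank_top] at this
  simpa using this

/-- Radical parts do not affect pairings, so a reflection acts on frame coordinates as a finite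
reflection and moves the translation by a multiple of `s`. -/
theorem fibre_reflect (hf : IsBCFrame J R e) (h : IsSemidefRootSystem J R) {u v : Fin k → ℝ}
    {r s : F} (hr : r ∈ fibre J R e v) (hs : s ∈ fibre J R e u) (t : ℝ)
    (ht : 2 * (u ⬝ᵥ v) = t * (u ⬝ᵥ u)) : r - t • s ∈ fibre J R e (v - t • u) := by
  refine ⟨(rad J).sub_mem hr.1 ((rad J).smul_mem t hs.1), ?_⟩
  have := h.reflect_mem _ hs.2 _ hr.2 t ?_
  · convert this using 1
    rw [map_sub, map_smul]
    module
  · have h1 : ∀ u v : Fin k → ℝ, J (comb e u) (comb e v) = u ⬝ᵥ v :=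
      hf.orthonormal.apply_comb_comb
    simp only [map_add, LinearMap.add_apply, h1, mem_rad_iff.1 hs.1, h.rad_right hs.1,
      h.rad_right hr.1]
    linarith

theorem neg_mem_fibre_neg (h : IsSemidefRootSystem J R) {v : Fin k → ℝ}
    {r : F} (hr : r ∈ fibre J R e v) : -r ∈ fibre J R e (-v) := by
  refine ⟨(rad J).neg_mem hr.1, ?_⟩
  convert h.neg_mem hr.2 using 1
  rw [map_neg]
  module

theorem zero_mem_fibre_single (hf : IsBCFrame J R e) (i : Fin k) :
    (0 : F) ∈ fibre J R e (Pi.single i 1) :=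
  ⟨zero_mem _, by simpa [comb_single] using hf.short_mem i⟩

theorem zero_mem_fibre_sub (hf : IsBCFrame J R e) {i j : Fin k} (hij : i ≠ j) :
    (0 : F) ∈ fibre J R e (Pi.single i 1 - Pi.single j 1) :=
  ⟨zero_mem _, by simpa [comb_single] using hf.sub_mem i j hij⟩

/-- The reflecting root `e i` carries zero translation, so `r` is unchanged. Together with
`fibre_swap` this makes the fibres invariant under all signed permutations of the coordinates. -/
theorem fibre_flip (hf : IsBCFrame J R e) (h : IsSemidefRootSystem J R) {v : Fin k → ℝ}
    {r : F} (hr : r ∈ fibre J R e v) (i : Fin k) :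
    r ∈ fibre J R e (v - (2 * v i) • Pi.single i 1) := by
  simpa using hf.fibre_reflect h hr (hf.zero_mem_fibre_single i) (2 * v i) (by simp)

theorem fibre_swap (hf : IsBCFrame J R e) (h : IsSemidefRootSystem J R) {v : Fin k → ℝ}
    {r : F} (hr : r ∈ fibre J R e v) (i j : Fin k) :
    r ∈ fibre J R e (v ∘ Equiv.swap i j) := by
  by_cases hij : i = j
  · subst hij
    simpa using hr
  have := hf.fibre_reflect h hr (hf.zero_mem_fibre_sub hij) (v i - v j) ?_
  · rw [smul_zero, sub_zero] at this
    convert this using 2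
    ext p
    by_cases hpi : p = i
    · subst hpi
      simp [hij]
    by_cases hpj : p = j
    · subst hpj
      simp [hpi]
    · simp [hpi, hpj, Equiv.swap_apply_of_ne_of_ne]
  · simp [hij, Ne.symm hij]
    ring

theorem fibre_single (hf : IsBCFrame J R e) (h : IsSemidefRootSystem J R) {c : ℝ}
    {r : F} {i : Fin k} (hr : r ∈ fibre J R e (Pi.single i c)) (j : Fin k) {d : ℝ}
    (hd : d = c ∨ d = -c) : r ∈ fibre J R e (Pi.single j d) := by
  have h1 := hf.fibre_swap h hr i j
  rw [Pi.single_comp_equiv, Equiv.symm_swap, Equiv.swap_apply_left] at h1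
  rcases hd with rfl | rfl
  · exact h1
  · convert hf.fibre_flip h h1 j using 2
    ext p
    by_cases hp : p = j
    · subst hp
      simp
      ring
    · simp [hp]

theorem fibre_middle (hf : IsBCFrame J R e) (h : IsSemidefRootSystem J R) {σ τ σ' τ' : ℝ}
    {r : F} {i j p q : Fin k} (hr : r ∈ fibre J R e (Pi.single i σ + Pi.single j τ))
    (hij : i ≠ j) (hpq : p ≠ q) (hσ : σ' = σ ∨ σ' = -σ) (hτ : τ' = τ ∨ τ' = -τ) :
    r ∈ fibre J R e (Pi.single p σ' + Pi.single q τ') := by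
  have hcomp : ∀ (i j a b : Fin k), r ∈ fibre J R e (Pi.single i σ + Pi.single j τ) →
      r ∈ fibre J R e (Pi.single (Equiv.swap a b i) σ + Pi.single (Equiv.swap a b j) τ) := by
    intro i j a b hr
    have h1 := hf.fibre_swap h hr a b
    rwa [Pi.add_comp, Pi.single_comp_equiv, Pi.single_comp_equiv, Equiv.symm_swap] at h1
  have h1 := hcomp _ _ i p hr
  rw [Equiv.swap_apply_left] at h1
  -- After `i` has been moved to `p`, a second transposition moves the image of `j` to `q` and must
  -- leave `p` fixed.
  have hj : Equiv.swap i p j ≠ p := by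
    intro hc
    exact hij ((Equiv.swap i p).injective (hc.trans (Equiv.swap_apply_left i p).symm)).symm
  have h2 := hcomp _ _ (Equiv.swap i p j) q h1
  rw [Equiv.swap_apply_left, Equiv.swap_apply_of_ne_of_ne hj.symm hpq] at h2
  have h3 : r ∈ fibre J R e (Pi.single p σ' + Pi.single q τ) := by
    rcases hσ with rfl | rfl
    · exact h2
    · convert hf.fibre_flip h h2 p using 2
      ext a
      by_cases ha : a = p
      · subst ha
        simp [hpq]
        ring
      · simp [ha]
  rcases hτ with rfl | rfl
  · exact h3
  · convert hf.fibre_flip h h3 q using 2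
    ext a
    by_cases ha : a = q
    · subst ha
      simp [hpq.symm]
      ring
    · simp [ha]

end IsBCFrame

/-! ### The translation sets `S`, `M`, `L` and the lattice they generate -/

/-- The sets `S`, `M`, `L` of translations of the short, middle and long roots over a frame,
together with the closure properties forced by the reflections. -/
structure IsBCFibration (J : LinearMap.BilinForm ℝ F) (R : Set F) {k : ℕ} (e : Fin k → F)
    (S M L : Set F) : Prop where
  short : ∀ v, IsShortVec v → fibre J R e v = S
  middle : ∀ v, IsMiddleVec v → fibre J R e v = M
  long : ∀ v, IsLongVec v → fibre J R e v = L
  zero_mem_S : 0 ∈ S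
  zero_mem_M : 0 ∈ M
  nonempty_L : L.Nonempty
  neg_S : ∀ s ∈ S, -s ∈ S
  S_add_S : ∀ s ∈ S, ∀ s' ∈ S, s + (2 : ℝ) • s' ∈ S
  S_add_M : ∀ s ∈ S, ∀ m ∈ M, s + m ∈ S
  S_add_L : ∀ s ∈ S, ∀ x ∈ L, s + x ∈ S
  M_add_S : ∀ m ∈ M, ∀ s ∈ S, m + (2 : ℝ) • s ∈ M
  M_add_L : ∀ m ∈ M, ∀ x ∈ L, m + x ∈ M
  L_add_S : ∀ x ∈ L, ∀ s ∈ S, x + (4 : ℝ) • s ∈ L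
  L_add_M : ∀ x ∈ L, ∀ m ∈ M, x + (2 : ℝ) • m ∈ L
  L_add_L : ∀ x ∈ L, ∀ y ∈ L, x + (2 : ℝ) • y ∈ L

namespace IsBCFrame

open IsSemidefRootSystem

variable {J : LinearMap.BilinForm ℝ F} {R : Set F} {k : ℕ} {e : Fin k → F}

theorem exists_fibration (hf : IsBCFrame J R e) (h : IsSemidefRootSystem J R) (hk : 0 < k) :
    ∃ S M L : Set F, IsBCFibration J R e S M L := by
  let o : Fin k := ⟨0, hk⟩
  set S := fibre J R e (Pi.single o 1) with hS
  set L := fibre J R e (Pi.single o 2) with hL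
  have short : ∀ v, IsShortVec v → fibre J R e v = S := by
    rintro v ⟨i, σ, hσ, rfl⟩
    ext r
    refine ⟨fun hr => hf.fibre_single h hr o ?_, fun hr => hf.fibre_single h hr i hσ⟩
    rcases hσ with rfl | rfl <;> simp
  have long : ∀ v, IsLongVec v → fibre J R e v = L := by
    rintro v ⟨i, σ, hσ, rfl⟩
    ext r
    refine ⟨fun hr => hf.fibre_single h hr o ?_, fun hr => hf.fibre_single h hr i ?_⟩ <;>
    rcases hσ with rfl | rfl <;> simp
  have neg_S : ∀ s ∈ S, -s ∈ S := fun s hs => by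
    have := neg_mem_fibre_neg h hs
    rwa [short _ ⟨o, -1, Or.inr rfl, Pi.single_neg _ _ |>.symm⟩] at this
  have neg_L : ∀ s ∈ L, -s ∈ L := fun s hs => by
    have := neg_mem_fibre_neg h hs
    rwa [long _ ⟨o, -1, Or.inr rfl, by rw [← Pi.single_neg]; norm_num⟩] at this
  have hSS : ∀ s ∈ S, ∀ s' ∈ S, s + (2 : ℝ) • s' ∈ S := fun s hs s' hs' => by
    have := hf.fibre_reflect h hs (neg_S _ hs') 2 rfl
    rw [short _ ⟨o, -1, Or.inr rfl, by ext; simp [Pi.single_apply]; split_ifs <;> norm_num⟩] at this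
    simpa using this
  have hSL : ∀ s ∈ S, ∀ x ∈ L, s + x ∈ S := fun s hs x hx => by
    have := hf.fibre_reflect h hs (neg_L _ hx) 1 (by simp)
    rw [short _ ⟨o, -1, Or.inr rfl, by ext; simp [Pi.single_apply]; split_ifs <;> norm_num⟩] at this
    simpa using this
  have hLS : ∀ x ∈ L, ∀ s ∈ S, x + (4 : ℝ) • s ∈ L := fun x hx s hs => by
    have := hf.fibre_reflect h hx (neg_S _ hs) 4 (by simp; norm_num)
    rw [long _ ⟨o, -1, Or.inr rfl, by ext; simp [Pi.single_apply]; split_ifs <;> norm_num⟩] at this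
    simpa using this
  have hLL : ∀ x ∈ L, ∀ y ∈ L, x + (2 : ℝ) • y ∈ L := fun x hx y hy => by
    have := hf.fibre_reflect h hx (neg_L _ hy) 2 rfl
    rw [long _ ⟨o, -1, Or.inr rfl, by ext; simp [Pi.single_apply]; split_ifs <;> norm_num⟩] at this
    simpa using this
  have h0S : (0 : F) ∈ S := hf.zero_mem_fibre_single o
  have hLne : L.Nonempty := by
    obtain ⟨f, hfR, hfr⟩ := hf.double o
    exact ⟨_, hfr, by rw [comb_single]; simpa using hfR⟩
  by_cases hk1 : ∃ p : Fin k, p ≠ o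
  · obtain ⟨p, hp⟩ := hk1
    have hop := hp.symm
    set M := fibre J R e (Pi.single o 1 + Pi.single p 1) with hM
    have middle : ∀ v, IsMiddleVec v → fibre J R e v = M := by
      rintro v ⟨i, j, hij, σ, τ, hσ, hτ, rfl⟩
      ext r
      refine ⟨fun hr => hf.fibre_middle h hr hij hop ?_ ?_,
        fun hr => hf.fibre_middle h hr hop hij hσ hτ⟩
      · rcases hσ with rfl | rfl <;> simp
      · rcases hτ with rfl | rfl <;> simp
    have neg_M : ∀ s ∈ M, -s ∈ M := fun s hs => by
      have := neg_mem_fibre_neg h hs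
      rwa [middle _ ⟨o, p, hop, -1, -1, Or.inr rfl, Or.inr rfl, by
        rw [neg_add, ← Pi.single_neg, ← Pi.single_neg]⟩] at this
    refine ⟨S, M, L, short, middle, long, h0S, ?_, hLne, neg_S, hSS, fun s hs m hm => ?_, hSL,
      fun m hm s hs => ?_, fun m hm x hx => ?_, hLS, fun x hx m hm => ?_, hLL⟩
    · rw [← middle (Pi.single o 1 - Pi.single p 1) ⟨o, p, hop, 1, -1, Or.inl rfl, Or.inr rfl, by
        rw [sub_eq_add_neg, ← Pi.single_neg]⟩]
      exact hf.zero_mem_fibre_sub hop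
    · have := hf.fibre_reflect h hs (neg_M _ hm) 1 (by simp [hop, hp]; norm_num)
      rw [short _ ⟨p, -1, Or.inr rfl, by rw [Pi.single_neg]; module⟩] at this
      simpa using this
    · have := hf.fibre_reflect h hm (neg_S _ hs) 2 (by simp [hop])
      rw [middle _ ⟨o, p, hop, -1, 1, Or.inr rfl, Or.inl rfl, by
        rw [Pi.single_neg]; module⟩] at this
      simpa using this
    · have := hf.fibre_reflect h hm (neg_L _ hx) 1 (by simp [hop])
      rw [middle _ ⟨o, p, hop, -1, 1, Or.inr rfl, Or.inl rfl, by
        ext a; simp [Pi.single_apply]; split_ifs <;> norm_num⟩] at this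
      simpa using this
    · have := hf.fibre_reflect h hx (neg_M _ hm) 2 (by simp [hop, hp]; norm_num)
      rw [long _ ⟨p, -1, Or.inr rfl, by
        ext a; simp [Pi.single_apply]; split_ifs <;> norm_num⟩] at this
      simpa using this
  · push Not at hk1
    -- In rank one there are no middle vectors and `M` is at one's disposal. The largest set
    -- compatible with `S_add_M` and `L_add_M` also satisfies the other closure properties.
    refine ⟨S, {m | (∀ s ∈ S, s + m ∈ S) ∧ ∀ x ∈ L, x + (2 : ℝ) • m ∈ L}, L, short, ?_, long, h0S,
      ⟨by simp, by simp⟩, hLne, neg_S, hSS, fun s hs m hm => hm.1 s hs, hSL,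
      fun m hm s hs => ⟨fun s' hs' => ?_, fun x hx => ?_⟩,
      fun m hm x hx => ⟨fun s' hs' => ?_, fun y hy => ?_⟩, hLS, fun x hx m hm => hm.2 x hx, hLL⟩
    · rintro v ⟨i, j, hij, -⟩
      exact absurd ((hk1 i).trans (hk1 j).symm) hij
    · rw [← add_assoc]
      exact hSS _ (hm.1 _ hs') _ hs
    · convert hLS _ (hm.2 _ hx) _ hs using 1
      module
    · rw [← add_assoc]
      exact hSL _ (hm.1 _ hs') _ hx
    · convert hLL _ (hm.2 _ hy) _ hx using 1
      module

end IsBCFrame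

namespace IsBCFibration

open IsSemidefRootSystem

variable {J : LinearMap.BilinForm ℝ F} {R : Set F} {k : ℕ} {e : Fin k → F} {S M L : Set F}

theorem M_subset (fb : IsBCFibration J R e S M L) : M ⊆ S := fun m hm => by
  simpa using fb.S_add_M 0 fb.zero_mem_S m hm

theorem L_subset (fb : IsBCFibration J R e S M L) : L ⊆ S := fun m hm => by
  simpa using fb.S_add_L 0 fb.zero_mem_S m hm

theorem S_subset_rad (fb : IsBCFibration J R e S M L) (hk : 0 < k) : S ⊆ rad J := fun s hs => by
  rw [← fb.short _ ⟨⟨0, hk⟩, 1, Or.inl rfl, rfl⟩] at hs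
  exact hs.1

theorem S_subset_rootLattice (fb : IsBCFibration J R e S M L) (hk : 0 < k) :
    S ⊆ rootLattice R := fun s hs => by
  have h0 := fb.zero_mem_S
  rw [← fb.short _ ⟨⟨0, hk⟩, 1, Or.inl rfl, rfl⟩] at hs h0
  have := (rootLattice R).sub_mem (Submodule.subset_span hs.2) (Submodule.subset_span h0.2)
  simpa using this

theorem exists_int_coords (fb : IsBCFibration J R e S M L) (hf : IsBCFrame J R e) {x : F}
    (hx : x ∈ R) : ∃ n : Fin k → ℤ, x - comb e (fun i => (n i : ℝ)) ∈ S := by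
  obtain ⟨v, hv, hxv⟩ := hf.form x hx
  have hfib : x - comb e v ∈ fibre J R e v := ⟨hxv, by simpa using hx⟩
  have hS : x - comb e v ∈ S := by
    rcases hv with hv | hv | hv
    · rwa [fb.short v hv] at hfib
    · rw [fb.middle v hv] at hfib
      exact fb.M_subset hfib
    · rw [fb.long v hv] at hfib
      exact fb.L_subset hfib
  have hcoord : ∀ i, ∃ n : ℤ, v i = n := by
    have sgn : ∀ σ : ℝ, σ = 1 ∨ σ = -1 → ∃ n : ℤ, σ = n := by
      rintro σ (rfl | rfl)
      · exact ⟨1, by simp⟩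
      · exact ⟨-1, by simp⟩
    have sgl : ∀ (p i : Fin k) (n : ℤ), ∃ m : ℤ, (Pi.single p (n : ℝ) : Fin k → ℝ) i = m := by
      intro p i n
      by_cases hp : i = p
      · subst hp
        exact ⟨n, by simp⟩
      · exact ⟨0, by simp [hp]⟩
    intro i
    rcases hv with ⟨p, σ, hσ, rfl⟩ | ⟨p, q, hpq, σ, τ, hσ, hτ, rfl⟩ | ⟨p, σ, hσ, rfl⟩
    · obtain ⟨n, rfl⟩ := sgn σ hσ
      exact sgl p i n
    · obtain ⟨n, rfl⟩ := sgn σ hσ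
      obtain ⟨m, rfl⟩ := sgn τ hτ
      obtain ⟨n', hn⟩ := sgl p i n
      obtain ⟨m', hm⟩ := sgl q i m
      exact ⟨n' + m', by simp [hn, hm]⟩
    · obtain ⟨n, rfl⟩ := sgn σ hσ
      simpa using sgl p i (2 * n)
  choose n hn using hcoord
  refine ⟨n, ?_⟩
  rwa [← (funext hn : v = fun i => (n i : ℝ))]

/-- Every lattice vector is an integral combination of the frame plus an element of the span of `S`;
for a radical vector, pairing with the frame kills the first part. Thus a lattice vector on the
marked line lies in the lattice generated by `S`. -/
theorem rootLattice_inter_rad (fb : IsBCFibration J R e S M L) (h : IsSemidefRootSystem J R)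
    (hf : IsBCFrame J R e) (hk : 0 < k) {x : F} (hx : x ∈ rootLattice R) (hxr : x ∈ rad J) :
    x ∈ Submodule.span ℤ S := by
  have key : ∃ n : Fin k → ℤ, x - comb e (fun i => (n i : ℝ)) ∈ Submodule.span ℤ S := by
    clear hxr
    induction hx using Submodule.span_induction with
    | mem x hx =>
      obtain ⟨n, hn⟩ := fb.exists_int_coords hf hx
      exact ⟨n, Submodule.subset_span hn⟩
    | zero =>
      refine ⟨0, ?_⟩
      have : (fun i : Fin k => (((0 : Fin k → ℤ) i : ℤ) : ℝ)) = 0 := by ext; simp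
      rw [this]
      simp
    | add x y _ _ hx hy =>
      obtain ⟨n, hn⟩ := hx
      obtain ⟨m, hm⟩ := hy
      refine ⟨n + m, ?_⟩
      have : (fun i : Fin k => (((n + m) i : ℤ) : ℝ)) = (fun i => (n i : ℝ)) + fun i => (m i : ℝ) := by
        ext; simp
      rw [this, map_add]
      convert Submodule.add_mem _ hn hm using 1
      module
    | smul c x _ hx =>
      obtain ⟨n, hn⟩ := hx
      refine ⟨c • n, ?_⟩
      have : (fun i : Fin k => (((c • n) i : ℤ) : ℝ)) = c • (fun i => (n i : ℝ)) := by
        ext; simp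
      rw [this, map_zsmul, ← smul_sub]
      exact Submodule.smul_mem _ c hn
  obtain ⟨n, hn⟩ := key
  have hsub : ∀ y ∈ Submodule.span ℤ S, y ∈ rad J := fun y hy =>
    (Submodule.span_le (p := (rad J).restrictScalars ℤ)).2 (fb.S_subset_rad hk) hy
  have h0 : (fun i => (n i : ℝ)) = 0 := by
    ext i
    have h1 := h.apply_of_sub_comb_mem hf.orthonormal (hsub _ hn) i
    rw [h.rad_right hxr] at h1
    exact h1.symm
  rw [h0] at hn
  simpa using hn

theorem span_S (fb : IsBCFibration J R e S M L) (h : IsSemidefRootSystem J R)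
    (hf : IsBCFrame J R e) (hk : 0 < k) (hspan : Submodule.span ℝ R = ⊤) :
    Submodule.span ℝ S = rad J := by
  refine le_antisymm (Submodule.span_le.2 (fb.S_subset_rad hk)) fun x hxr => ?_
  have key : ∃ v : Fin k → ℝ, x - comb e v ∈ Submodule.span ℝ S := by
    have hx : x ∈ Submodule.span ℝ R := hspan ▸ Submodule.mem_top
    clear hxr
    induction hx using Submodule.span_induction with
    | mem x hx =>
      obtain ⟨n, hn⟩ := fb.exists_int_coords hf hx
      exact ⟨_, Submodule.subset_span hn⟩
    | zero => exact ⟨0, by simp⟩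
    | add x y _ _ hx hy =>
      obtain ⟨n, hn⟩ := hx
      obtain ⟨m, hm⟩ := hy
      refine ⟨n + m, ?_⟩
      rw [map_add]
      convert Submodule.add_mem _ hn hm using 1
      module
    | smul c x _ hx =>
      obtain ⟨n, hn⟩ := hx
      refine ⟨c • n, ?_⟩
      rw [map_smul, ← smul_sub]
      exact Submodule.smul_mem _ c hn
  obtain ⟨v, hv⟩ := key
  have h0 : v = 0 := by
    ext i
    have h1 := h.apply_of_sub_comb_mem hf.orthonormal
      (Submodule.span_le.2 (fb.S_subset_rad hk) hv) i
    rw [h.rad_right hxr] at h1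
    exact h1.symm
  rw [h0] at hv
  simpa using hv

end IsBCFibration

/-! ### A lattice basis adapted to the marking -/

/-- A discrete subgroup of rank two has a `ℤ`-basis whose first vector lies on a given line that
meets the subgroup non-trivially. -/
theorem exists_adapted_basis [FiniteDimensional ℝ F] {S : Set F} {G : Submodule ℝ F}
    (hd : DiscreteTopology (Submodule.span ℤ S))
    (hrank : Module.finrank ℝ (Submodule.span ℝ S) = 2) (hG : Module.finrank ℝ G = 1) {g : F}
    (hgG : g ∈ G) (hg0 : g ≠ 0) (hgS : g ∈ Submodule.span ℤ S) :
    ∃ a b : F, LinearIndependent ℝ ![a, b] ∧ Submodule.span ℝ {a, b} = Submodule.span ℝ S ∧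
      Submodule.span ℝ {a} = G ∧
      ∀ r, r ∈ Submodule.span ℤ S ↔ ∃ m n : ℤ, r = (m : ℝ) • a + (n : ℝ) • b := by
  have : Module.Free ℤ (Submodule.span ℤ S) := inferInstance
  have : Module.Finite ℤ (Submodule.span ℤ S) := inferInstance
  have hrk : Module.finrank ℤ (Submodule.span ℤ S) = 2 := by
    have := Real.finrank_eq_int_finrank_of_discrete hd
    rw [Set.finrank, Set.finrank, hrank] at this
    exact this.symm
  let B := Module.finBasisOfFinrankEq ℤ (Submodule.span ℤ S) hrk
  set u : F := (B 0 : F) with hu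
  set w : F := (B 1 : F) with hw
  have huw : ∀ r, r ∈ Submodule.span ℤ S ↔ ∃ m n : ℤ, r = (m : ℝ) • u + (n : ℝ) • w := by
    intro r
    constructor
    · intro hr
      refine ⟨B.repr ⟨r, hr⟩ 0, B.repr ⟨r, hr⟩ 1, ?_⟩
      have := congrArg Subtype.val (B.sum_repr ⟨r, hr⟩)
      rw [Fin.sum_univ_two] at this
      simp only [Int.cast_smul_eq_zsmul]
      simpa using this.symm
    · rintro ⟨m, n, rfl⟩
      simp only [Int.cast_smul_eq_zsmul]
      exact Submodule.add_mem _ (Submodule.smul_mem _ _ (B 0).2) (Submodule.smul_mem _ _ (B 1).2)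
  obtain ⟨p, q, hpq⟩ := (huw g).1 hgS
  -- Dividing `g` by the gcd of its coordinates gives a primitive vector `(p', q')` on the same
  -- line; the Bézout coefficients `x`, `y` complete it by `(-y, x)` to a matrix of determinant one.
  have hd0 : 0 < Int.gcd p q := by
    rw [Int.gcd_pos_iff]
    by_contra! hc
    exact hg0 (by rw [hpq, hc.1, hc.2]; simp)
  obtain ⟨p', hp'⟩ := Int.gcd_dvd_left p q
  obtain ⟨q', hq'⟩ := Int.gcd_dvd_right p q
  have hd1 : ((Int.gcd p q : ℤ)) ≠ 0 := by exact_mod_cast hd0.ne'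
  have hbez : p' * Int.gcdA p q + q' * Int.gcdB p q = 1 := by
    have h1 := Int.gcd_eq_gcd_ab p q
    have : (Int.gcd p q : ℤ) * (p' * Int.gcdA p q + q' * Int.gcdB p q) = Int.gcd p q * 1 := by
      linear_combination (-1 : ℤ) * h1 - Int.gcdA p q * hp' - Int.gcdB p q * hq'
    exact mul_left_cancel₀ hd1 this
  set x := Int.gcdA p q
  set y := Int.gcdB p q
  set d : ℤ := (Int.gcd p q : ℤ)
  have hbezR : (p' * x + q' * y : ℝ) = 1 := by exact_mod_cast hbez
  set a : F := (p' : ℝ) • u + (q' : ℝ) • w with ha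
  set b : F := (-y : ℝ) • u + (x : ℝ) • w with hb
  have hua : u = (x : ℝ) • a - (q' : ℝ) • b := by
    have : u = (p' * x + q' * y : ℝ) • u := by rw [hbezR, one_smul]
    rw [ha, hb]
    nth_rw 1 [this]
    module
  have hwa : w = (y : ℝ) • a + (p' : ℝ) • b := by
    have : w = (p' * x + q' * y : ℝ) • w := by rw [hbezR, one_smul]
    rw [ha, hb]
    nth_rw 1 [this]
    module
  have hab : ∀ r, r ∈ Submodule.span ℤ S ↔ ∃ m n : ℤ, r = (m : ℝ) • a + (n : ℝ) • b := by
    intro r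
    rw [huw]
    constructor
    · rintro ⟨m, n, rfl⟩
      refine ⟨m * x + n * y, n * p' - m * q', ?_⟩
      rw [hua, hwa]
      push_cast
      module
    · rintro ⟨m, n, rfl⟩
      refine ⟨m * p' - n * y, m * q' + n * x, ?_⟩
      rw [ha, hb]
      push_cast
      module
  have hspan : Submodule.span ℝ {a, b} = Submodule.span ℝ S := by
    apply le_antisymm
    · rw [Submodule.span_le]
      have hle := Submodule.span_le_restrictScalars ℤ ℝ S
      rintro z (rfl | rfl)
      · exact hle ((hab _).2 ⟨1, 0, by simp⟩)
      · exact hle ((hab _).2 ⟨0, 1, by simp⟩)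
    · rw [Submodule.span_le]
      intro s hs
      obtain ⟨m, n, rfl⟩ := (hab s).1 (Submodule.subset_span hs)
      exact Submodule.add_mem _ (Submodule.smul_mem _ _ (Submodule.subset_span (by simp)))
        (Submodule.smul_mem _ _ (Submodule.subset_span (by simp)))
  have hga : g = (d : ℝ) • a := by
    have hp'' : (p : ℝ) = d * p' := by exact_mod_cast hp'
    have hq'' : (q : ℝ) = d * q' := by exact_mod_cast hq'
    rw [hpq, ha, hp'', hq'']
    module
  have hdR : (d : ℝ) ≠ 0 := by exact_mod_cast hd1
  have haG : a ∈ G := by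
    have : a = (d : ℝ)⁻¹ • g := by rw [hga, smul_smul, inv_mul_cancel₀ hdR, one_smul]
    rw [this]
    exact G.smul_mem _ hgG
  have ha0 : a ≠ 0 := fun h0 => hg0 (by rw [hga, h0, smul_zero])
  refine ⟨a, b, ?_, hspan, ?_, hab⟩
  · rw [linearIndependent_iff_card_eq_finrank_span, Set.finrank]
    have : Set.range ![a, b] = {a, b} := by
      simp [Matrix.range_cons, Matrix.range_empty, Set.pair_comm]
    rw [this, hspan, hrank]
    simp
  · apply Submodule.eq_of_le_of_finrank_eq
    · rw [Submodule.span_singleton_le_iff_mem]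
      exact haG
    · rw [hG, finrank_span_singleton ha0]

/-! ### Classification of translation triples modulo 2 and 4 -/

/-- The closure properties of the translation sets of short, middle and long roots, in integral
coordinates along a basis of the lattice they generate, for a reduced system that becomes
non-reduced modulo the first basis vector. -/
structure IsTranslationTriple (S M L : ℤ → ℤ → Prop) : Prop where
  S_zero : S 0 0
  M_zero : M 0 0
  S_two : ∀ m n p q, S m n → S (m + 2 * p) (n + 2 * q)
  M_two : ∀ m n p q, M m n → M (m + 2 * p) (n + 2 * q)
  L_four : ∀ m n p q, L m n → L (m + 4 * p) (n + 4 * q)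
  S_add_M : ∀ m n p q, S m n → M p q → S (m + p) (n + q)
  S_add_L : ∀ m n p q, S m n → L p q → S (m + p) (n + q)
  M_add_L : ∀ m n p q, M m n → L p q → M (m + p) (n + q)
  L_add_M : ∀ m n p q, L m n → M p q → L (m + 2 * p) (n + 2 * q)
  L_add_L : ∀ m n p q, L m n → L p q → L (m + 2 * p) (n + 2 * q)
  reduced : ∀ m n, S m n → ¬ L (2 * m) (2 * n)
  generates : ∀ x y : ℤ, Odd x ∨ Odd y → ∃ m n, S m n ∧ Odd (x * m + y * n)
  nonreduced : ∃ m p q, L m (2 * q) ∧ S p q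

/-- After the shift of origin by `(c₁, c₂)` and the change of basis `b ↦ b + t a`, the triple
`(S, M, L)` becomes `(S₀, M₀, L₀)`. -/
def HasNormalForm (S M L S₀ M₀ L₀ : ℤ → ℤ → Prop) : Prop :=
  ∃ c₁ c₂ t : ℤ, ∀ m n, (S (m + t * n + c₁) (n + c₂) ↔ S₀ m n) ∧ (M (m + t * n) n ↔ M₀ m n) ∧
    (L (m + t * n + 2 * c₁) (n + 2 * c₂) ↔ L₀ m n)

namespace IsTranslationTriple

variable {S M L : ℤ → ℤ → Prop}

theorem S_congr (h : IsTranslationTriple S M L) {m n p q : ℤ} (hm : 2 ∣ p - m) (hn : 2 ∣ q - n)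
    (hs : S m n) : S p q := by
  obtain ⟨x, hx⟩ := hm
  obtain ⟨y, hy⟩ := hn
  have := h.S_two m n x y hs
  rwa [← hx, ← hy, add_sub_cancel, add_sub_cancel] at this

theorem M_congr (h : IsTranslationTriple S M L) {m n p q : ℤ} (hm : 2 ∣ p - m) (hn : 2 ∣ q - n)
    (hs : M m n) : M p q := by
  obtain ⟨x, hx⟩ := hm
  obtain ⟨y, hy⟩ := hn
  have := h.M_two m n x y hs
  rwa [← hx, ← hy, add_sub_cancel, add_sub_cancel] at this

theorem L_congr (h : IsTranslationTriple S M L) {m n p q : ℤ} (hm : 4 ∣ p - m) (hn : 4 ∣ q - n)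
    (hs : L m n) : L p q := by
  obtain ⟨x, hx⟩ := hm
  obtain ⟨y, hy⟩ := hn
  have := h.L_four m n x y hs
  rwa [← hx, ← hy, add_sub_cancel, add_sub_cancel] at this

/-- At most one class modulo two is missing from `S`. -/
theorem missing_class_unique (h : IsTranslationTriple S M L) {c₁ c₂ m n : ℤ} (hc : ¬ S c₁ c₂)
    (hmn : ¬ S m n) : 2 ∣ m - c₁ ∧ 2 ∣ n - c₂ := by
  by_contra hne
  have hc0 : ¬ (2 ∣ c₁ ∧ 2 ∣ c₂) := fun hd =>
    hc (h.S_congr (by simpa using hd.1) (by simpa using hd.2) h.S_zero)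
  have hm0 : ¬ (2 ∣ m ∧ 2 ∣ n) := fun hd =>
    hmn (h.S_congr (by simpa using hd.1) (by simpa using hd.2) h.S_zero)
  -- With two distinct non-zero classes missing, `S` lies in the classes of zero and of their sum.
  -- The chosen linear form vanishes modulo 2 on both, contradicting that `S` generates the lattice.
  obtain ⟨p, q, hpq, hodd⟩ := h.generates (c₂ + n) (c₁ + m) (by
    simp only [Int.odd_iff]
    omega)
  have hpc : ¬ (2 ∣ c₁ - p ∧ 2 ∣ c₂ - q) := fun hd => hc (h.S_congr hd.1 hd.2 hpq)
  have hpm : ¬ (2 ∣ m - p ∧ 2 ∣ n - q) := fun hd => hmn (h.S_congr hd.1 hd.2 hpq)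
  rw [Int.odd_add, Int.odd_mul, Int.even_mul] at hodd
  simp only [Int.odd_iff, Int.even_iff] at hodd
  omega

/-- Here `S` is the complement of one class `c` modulo 2. A translation by `M` or `L` outside the
even lattice would carry some element of `S` to `c`, so `M` and `L` are even; reducedness then
forces halves of elements of `L` into the class `c`. Moving the origin to `c`, which is not in `S`,
gives the `BC44star` pattern. -/
theorem normalForm_of_missing (h : IsTranslationTriple S M L) {c₁ c₂ : ℤ} (hc : ¬ S c₁ c₂) :
    HasNormalForm S M L (fun m n => Odd m ∨ Odd n) (fun m n => 2 ∣ m ∧ 2 ∣ n)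
      (fun m n => 4 ∣ m ∧ 4 ∣ n) := by
  have hS : ∀ m n, S m n ↔ ¬ (2 ∣ m - c₁ ∧ 2 ∣ n - c₂) := by
    intro m n
    constructor
    · rintro hs ⟨h1, h2⟩
      exact hc (h.S_congr (by omega) (by omega) hs)
    · intro hne
      by_contra hs
      exact hne (h.missing_class_unique hc hs)
  have hM : ∀ m n, M m n → 2 ∣ m ∧ 2 ∣ n := by
    intro m n hm
    by_contra hne
    have h1 := h.S_add_M (c₁ - m) (c₂ - n) m n ((hS _ _).2 (by omega)) hm
    rw [sub_add_cancel, sub_add_cancel] at h1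
    exact hc h1
  have hL2 : ∀ m n, L m n → 2 ∣ m ∧ 2 ∣ n := by
    intro m n hm
    by_contra hne
    have h1 := h.S_add_L (c₁ - m) (c₂ - n) m n ((hS _ _).2 (by omega)) hm
    rw [sub_add_cancel, sub_add_cancel] at h1
    exact hc h1
  have hL : ∀ m n, L m n → 4 ∣ m - 2 * c₁ ∧ 4 ∣ n - 2 * c₂ := by
    intro m n hm
    obtain ⟨⟨m, rfl⟩, ⟨n, rfl⟩⟩ := hL2 m n hm
    have h1 : ¬ S m n := fun hs => h.reduced m n hs hm
    rw [hS, not_not] at h1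
    omega
  obtain ⟨x, -, y, hxy, -⟩ := h.nonreduced
  refine ⟨c₁, c₂, 0, fun m n => ⟨?_, ⟨fun hm => ?_, fun hm => ?_⟩, ⟨fun hm => ?_, fun hm => ?_⟩⟩⟩
  · rw [hS]
    simp only [Int.odd_iff]
    omega
  · have := hM _ _ hm
    omega
  · exact h.M_congr (by omega) (by omega) h.M_zero
  · have := hL _ _ hm
    omega
  · have := hL _ _ hxy
    exact h.L_congr (by omega) (by omega) hxy

/-- When `S` is the whole lattice, reducedness forbids points of `L` with both coordinates even,
while `nonreduced` puts some `(x, 2q)` with `x` odd in `L`, hence in `M`. So `M` contains every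
point with even second coordinate, and is either that set or everything. In the latter case `L` is a
union of classes modulo 2; in the former it is governed by its second coordinate modulo 4. -/
theorem normalForm (h : IsTranslationTriple S M L) :
    HasNormalForm S M L (fun _ _ => True) (fun _ _ => True) (fun m _ => Odd m) ∨
    HasNormalForm S M L (fun _ _ => True) (fun _ _ => True) (fun m n => Odd m ∨ Odd n) ∨
    HasNormalForm S M L (fun _ _ => True) (fun _ n => 2 ∣ n) (fun m n => Odd m ∧ 4 ∣ n) ∨
    HasNormalForm S M L (fun m n => Odd m ∨ Odd n) (fun m n => 2 ∣ m ∧ 2 ∣ n)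
      (fun m n => 4 ∣ m ∧ 4 ∣ n) ∨
    HasNormalForm S M L (fun _ _ => True) (fun _ n => 2 ∣ n) (fun m n => Odd m ∧ 2 ∣ n) ∨
    HasNormalForm S M L (fun _ _ => True) (fun _ _ => True) (fun m n => Odd m ∧ 2 ∣ n) := by
  by_cases hS : ∀ m n, S m n
  swap
  · push Not at hS
    obtain ⟨c₁, c₂, hc⟩ := hS
    exact Or.inr (Or.inr (Or.inr (Or.inl (h.normalForm_of_missing hc))))
  have hL0 : ∀ m n, L m n → ¬ (2 ∣ m ∧ 2 ∣ n) := by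
    rintro m n hl ⟨⟨m, rfl⟩, ⟨n, rfl⟩⟩
    exact h.reduced m n (hS m n) hl
  obtain ⟨x, -, q, hx, -⟩ := h.nonreduced
  have hxodd : ¬ 2 ∣ x := fun hd => hL0 _ _ hx ⟨hd, by omega⟩
  have hML : ∀ m n, L m n → M m n := fun m n hl => by
    simpa using h.M_add_L 0 0 m n h.M_zero hl
  -- Adding `2(x, 2q)` to a point of `L` changes the first coordinate by 2 and the second by 0
  -- modulo 4, so both odd residues occur.
  have hodd : ∀ m n, ¬ 2 ∣ m → 4 ∣ n → L m (n + 2 * q) := by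
    intro m n hm hn
    by_cases hmx : 4 ∣ m - x
    · exact h.L_congr hmx (by omega) hx
    · exact h.L_congr (by omega) (by omega) (h.L_add_L _ _ _ _ hx hx)
  have hMeven : ∀ m n, 2 ∣ n → M m n := by
    intro m n hn
    by_cases hm : 2 ∣ m
    · exact h.M_congr (by omega) (by omega) h.M_zero
    · exact h.M_congr (by omega) (by omega) (hML _ _ hx)
  by_cases hM1 : ∃ m n, M m n ∧ ¬ 2 ∣ n
  · have hM : ∀ m n, M m n := by
      obtain ⟨y, z, hyz, hz⟩ := hM1
      intro m n
      by_cases hn : 2 ∣ n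
      · exact hMeven m n hn
      by_cases hm : 2 ∣ m - y
      · exact h.M_congr hm (by omega) hyz
      · exact h.M_congr (by omega) (by omega) (h.M_add_L _ _ _ _ hyz hx)
    have hL2 : ∀ {m n p r}, 2 ∣ p - m → 2 ∣ r - n → L m n → L p r := by
      rintro m n p r ⟨y, hy⟩ ⟨z, hz⟩ hl
      have := h.L_add_M m n y z hl (hM _ _)
      rwa [← hy, ← hz, add_sub_cancel, add_sub_cancel] at this
    have hL10 : ∀ m n, ¬ 2 ∣ m → 2 ∣ n → L m n := fun m n hm hn =>
      hL2 (by omega) (by omega) hx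
    -- The class `(1, 0)` is in `L` and `(0, 0)` is not; the other two classes modulo 2 are free.
    by_cases h01 : L 0 1 <;> by_cases h11 : L 1 1
    · refine Or.inr (Or.inl ⟨0, 0, 0, fun m n => ⟨by simp [hS], by simp [hM], ?_⟩⟩)
      simp only [Int.odd_iff]
      constructor
      · intro hl
        have := hL0 _ _ hl
        omega
      · intro hmn
        by_cases hn : 2 ∣ n
        · exact hL10 _ _ (by omega) (by omega)
        by_cases hm : 2 ∣ m
        · exact hL2 (by omega) (by omega) h01
        · exact hL2 (by omega) (by omega) h11
    -- Here `L` is given by `m + n` odd, and the shear `b ↦ b + a` turns this into `m` odd.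
    · refine Or.inl ⟨0, 0, 1, fun m n => ⟨by simp [hS], by simp [hM], ?_⟩⟩
      simp only [Int.odd_iff]
      constructor
      · intro hl
        have h1 := hL0 _ _ hl
        by_contra hm
        exact h11 (hL2 (by omega) (by omega) hl)
      · intro hm
        by_cases hn : 2 ∣ n
        · exact hL10 _ _ (by omega) (by omega)
        · exact hL2 (by omega) (by omega) h01
    · refine Or.inl ⟨0, 0, 0, fun m n => ⟨by simp [hS], by simp [hM], ?_⟩⟩
      simp only [Int.odd_iff]
      constructor
      · intro hl
        have h1 := hL0 _ _ hl
        by_contra hm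
        exact h01 (hL2 (by omega) (by omega) hl)
      · intro hm
        by_cases hn : 2 ∣ n
        · exact hL10 _ _ (by omega) (by omega)
        · exact hL2 (by omega) (by omega) h11
    · refine Or.inr (Or.inr (Or.inr (Or.inr (Or.inr ⟨0, 0, 0, fun m n =>
        ⟨by simp [hS], by simp [hM], ?_⟩⟩))))
      simp only [Int.odd_iff]
      constructor
      · intro hl
        have h1 := hL0 _ _ hl
        by_contra hm
        by_cases hm2 : 2 ∣ m
        · exact h01 (hL2 (by omega) (by omega) hl)
        · exact h11 (hL2 (by omega) (by omega) hl)
      · intro hm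
        exact hL10 _ _ (by omega) (by omega)
  · push Not at hM1
    have hM : ∀ m n, M m n ↔ 2 ∣ n := fun m n => ⟨hM1 m n, hMeven m n⟩
    have hL : ∀ m n, L m n → ¬ 2 ∣ m ∧ 2 ∣ n := fun m n hl => by
      have h1 := hL0 _ _ hl
      have h2 := hM1 _ _ (hML _ _ hl)
      omega
    -- The second coordinates occurring in `L` are even and include the class of `2q` modulo 4; the
    -- question is whether the other even class occurs. Shifting the origin by `(0, q)` moves `2q`
    -- to 0.
    by_cases h12 : L 1 (2 + 2 * q)
    · refine Or.inr (Or.inr (Or.inr (Or.inr (Or.inl ⟨0, q, 0, fun m n =>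
        ⟨by simp [hS], by simp [hM], ?_⟩⟩))))
      simp only [Int.odd_iff]
      constructor
      · intro hl
        have := hL _ _ hl
        omega
      · intro hm
        by_cases hn : 4 ∣ n
        · have := hodd m n (by omega) hn
          exact h.L_congr (by omega) (by omega) this
        by_cases hm1 : 4 ∣ m - 1
        · exact h.L_congr (by omega) (by omega) h12
        · exact h.L_congr (by omega) (by omega) (h.L_add_L _ _ _ _ h12 hx)
    · refine Or.inr (Or.inr (Or.inl ⟨0, q, 0, fun m n => ⟨by simp [hS], by simp [hM], ?_⟩⟩))
      simp only [Int.odd_iff]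
      constructor
      · intro hl
        have h1 := hL _ _ hl
        by_contra hm
        by_cases hm1 : 4 ∣ m - 1
        · exact h12 (h.L_congr (by omega) (by omega) hl)
        · exact h12 (h.L_congr (by omega) (by omega) (h.L_add_L _ _ _ _ hl hx))
      · intro hm
        have := hodd m n (by omega) hm.2
        exact h.L_congr (by omega) (by omega) this

end IsTranslationTriple

/-! ### The standard systems in integral coordinates -/

section ModelSets

variable {l : ℕ}

theorem mem_bcShort_iff (x : Space l) : x ∈ bcShort l ↔ IsShortVec x.1 ∧ x.2 = 0 := by
  constructor
  · rintro ⟨i, rfl | rfl⟩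
    · exact ⟨⟨i, 1, Or.inl rfl, rfl⟩, rfl⟩
    · exact ⟨⟨i, -1, Or.inr rfl, by simp [ε, Pi.single_neg]⟩, by simp [ε]⟩
  · rintro ⟨⟨i, σ, hσ, h1⟩, h2⟩
    refine ⟨i, hσ.imp ?_ ?_⟩
    · rintro rfl
      exact Prod.ext h1 h2
    · rintro rfl
      refine Prod.ext ?_ ?_
      · simpa [ε, Pi.single_neg] using h1
      · simpa [ε] using h2

theorem mem_bcLong_iff (x : Space l) : x ∈ bcLong l ↔ IsLongVec x.1 ∧ x.2 = 0 := by
  constructor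
  · rintro ⟨i, rfl | rfl⟩
    · exact ⟨⟨i, 1, Or.inl rfl, by simp [ε, ← Pi.single_smul]⟩, by simp [ε]⟩
    · exact ⟨⟨i, -1, Or.inr rfl, by simp [ε, ← Pi.single_smul, Pi.single_neg]⟩, by simp [ε]⟩
  · rintro ⟨⟨i, σ, hσ, h1⟩, h2⟩
    refine ⟨i, hσ.imp ?_ ?_⟩
    · rintro rfl
      refine Prod.ext ?_ ?_
      · simpa [ε, ← Pi.single_smul] using h1
      · simpa [ε] using h2
    · rintro rfl
      refine Prod.ext ?_ ?_
      · simpa [ε, ← Pi.single_smul, Pi.single_neg] using h1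
      · simpa [ε] using h2

theorem mem_bcMiddle_iff (x : Space l) : x ∈ bcMiddle l ↔ IsMiddleVec x.1 ∧ x.2 = 0 := by
  constructor
  · rintro ⟨i, j, hij, rfl | rfl | rfl | rfl⟩
    · exact ⟨⟨i, j, hij.ne, 1, 1, Or.inl rfl, Or.inl rfl, by simp [ε]⟩, by simp [ε]⟩
    · exact ⟨⟨i, j, hij.ne, -1, -1, Or.inr rfl, Or.inr rfl, by
        simp [ε, Pi.single_neg, add_comm]⟩, by simp [ε]⟩
    · exact ⟨⟨i, j, hij.ne, 1, -1, Or.inl rfl, Or.inr rfl, by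
        simp [ε, Pi.single_neg, sub_eq_add_neg]⟩, by simp [ε]⟩
    · exact ⟨⟨i, j, hij.ne, -1, 1, Or.inr rfl, Or.inl rfl, by
        simp [ε, Pi.single_neg, sub_eq_add_neg, add_comm]⟩, by simp [ε]⟩
  · rintro ⟨⟨i, j, hij, σ, τ, hσ, hτ, h1⟩, h2⟩
    have key : ∀ (i j : Fin l), i < j → ∀ σ τ : ℝ, (σ = 1 ∨ σ = -1) → (τ = 1 ∨ τ = -1) →
        x.1 = Pi.single i σ + Pi.single j τ → x ∈ bcMiddle l := by
      intro i j hij σ τ hσ hτ h1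
      have hx : x = σ • ε l i + τ • ε l j := by
        refine Prod.ext ?_ ?_
        · simpa [ε, ← Pi.single_smul] using h1
        · simpa [ε] using h2
      refine ⟨i, j, hij, ?_⟩
      rcases hσ with rfl | rfl <;> rcases hτ with rfl | rfl
      · exact Or.inl (by rw [hx]; module)
      · exact Or.inr (Or.inr (Or.inl (by rw [hx]; module)))
      · exact Or.inr (Or.inr (Or.inr (by rw [hx]; module)))
      · exact Or.inr (Or.inl (by rw [hx]; module))
    rcases lt_or_gt_of_ne hij with hlt | hlt
    · exact key i j hlt σ τ hσ hτ h1
    · exact key j i hlt τ σ hτ hσ (by rw [h1, add_comm])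

/-- Translating a set of vectors without radical component by a set of radical vectors. -/
theorem mem_add_radical {A T : Set (Space l)} {P : (Fin l → ℝ) → Prop} {Q : ℝ × ℝ → Prop}
    (hA : ∀ x, x ∈ A ↔ P x.1 ∧ x.2 = 0) (hT : ∀ x, x ∈ T ↔ x.1 = 0 ∧ Q x.2) (x : Space l) :
    x ∈ A + T ↔ P x.1 ∧ Q x.2 := by
  rw [Set.mem_add]
  constructor
  · rintro ⟨y, hy, z, hz, rfl⟩
    rw [hA] at hy
    rw [hT] at hz
    simpa [hy.2, hz.1] using And.intro hy.1 hz.2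
  · rintro ⟨hP, hQ⟩
    exact ⟨(x.1, 0), (hA _).2 ⟨hP, rfl⟩, (0, x.2), (hT _).2 ⟨rfl, hQ⟩, by simp⟩

theorem mem_zmul_b_add (i : ℤ) {T : Set (Space l)} {Q : ℤ → Prop}
    (hT : ∀ x, x ∈ T ↔ ∃ m : ℤ, Q m ∧ x = (0, ((m : ℝ), 0))) (x : Space l) :
    x ∈ zmul i (b l) + T ↔
      x.1 = 0 ∧ ∃ m n : ℤ, x.2 = ((m : ℝ), (n : ℝ)) ∧ Q m ∧ i ∣ n := by
  rw [Set.mem_add]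
  constructor
  · rintro ⟨y, ⟨n, rfl⟩, z, hz, rfl⟩
    obtain ⟨m, hm, rfl⟩ := (hT z).1 hz
    refine ⟨by simp [b], m, i * n, by simp [b], hm, dvd_mul_right _ _⟩
  · rintro ⟨h1, m, n, h2, hm, ⟨p, rfl⟩⟩
    refine ⟨_, ⟨p, rfl⟩, _, (hT _).2 ⟨m, hm, rfl⟩, ?_⟩
    refine Prod.ext ?_ ?_
    · simp [b, h1]
    · simp [b, h2]

theorem mem_zmul_a (j : ℤ) (x : Space l) :
    x ∈ zmul j (a l) ↔ ∃ m : ℤ, j ∣ m ∧ x = (0, ((m : ℝ), 0)) := by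
  constructor
  · rintro ⟨n, rfl⟩
    exact ⟨j * n, dvd_mul_right _ _, by simp [a]⟩
  · rintro ⟨m, ⟨n, rfl⟩, rfl⟩
    exact ⟨n, by simp [a]⟩

theorem mem_oddA (x : Space l) :
    x ∈ oddA l ↔ ∃ m : ℤ, Odd m ∧ x = (0, ((m : ℝ), 0)) := by
  constructor
  · rintro ⟨n, rfl⟩
    exact ⟨1 + 2 * n, ⟨n, by ring⟩, by simp [a]⟩
  · rintro ⟨m, ⟨n, rfl⟩, rfl⟩
    exact ⟨n, by simp [a, add_comm]⟩

theorem mem_L11 (x : Space l) :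
    x ∈ L11 l ↔ x.1 = 0 ∧ ∃ m n : ℤ, x.2 = ((m : ℝ), (n : ℝ)) ∧ (Odd m ∨ Odd n) := by
  have key : ∀ m n : ℤ, (m - 1) * (n - 1) ≡ 0 [ZMOD 2] ↔ (Odd m ∨ Odd n) := by
    intro m n
    rw [Int.modEq_zero_iff_dvd, Int.prime_two.dvd_mul, Int.odd_iff, Int.odd_iff]
    omega
  constructor
  · rintro ⟨m, n, hmn, rfl⟩
    exact ⟨by simp [a, b], m, n, by simp [a, b], (key m n).1 hmn⟩
  · rintro ⟨h1, m, n, h2, hmn⟩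
    refine ⟨m, n, (key m n).2 hmn, Prod.ext ?_ ?_⟩
    · simp [a, b, h1]
    · simp [a, b, h2]

/-- The set of roots with prescribed integral translations `S`, `M`, `L` of the short, middle and
long vectors. -/
def model (l : ℕ) (S M L : ℤ → ℤ → Prop) : Set (Space l) :=
  {x | ∃ m n : ℤ, x.2 = ((m : ℝ), (n : ℝ)) ∧
    (IsShortVec x.1 ∧ S m n ∨ IsMiddleVec x.1 ∧ M m n ∨ IsLongVec x.1 ∧ L m n)}

theorem union_eq_model {A B C : Set (Space l)} {S M L : ℤ → ℤ → Prop}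
    (hA : ∀ x, x ∈ A ↔ IsShortVec x.1 ∧ ∃ m n : ℤ, x.2 = ((m : ℝ), (n : ℝ)) ∧ S m n)
    (hB : ∀ x, x ∈ B ↔ IsMiddleVec x.1 ∧ ∃ m n : ℤ, x.2 = ((m : ℝ), (n : ℝ)) ∧ M m n)
    (hC : ∀ x, x ∈ C ↔ IsLongVec x.1 ∧ ∃ m n : ℤ, x.2 = ((m : ℝ), (n : ℝ)) ∧ L m n) :
    A ∪ B ∪ C = model l S M L := by
  ext x
  rw [Set.mem_union, Set.mem_union, hA, hB, hC]
  constructor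
  · rintro ((⟨h1, m, n, h2, h3⟩ | ⟨h1, m, n, h2, h3⟩) | ⟨h1, m, n, h2, h3⟩)
    · exact ⟨m, n, h2, Or.inl ⟨h1, h3⟩⟩
    · exact ⟨m, n, h2, Or.inr (Or.inl ⟨h1, h3⟩)⟩
    · exact ⟨m, n, h2, Or.inr (Or.inr ⟨h1, h3⟩)⟩
  · rintro ⟨m, n, h2, ⟨h1, h3⟩ | ⟨h1, h3⟩ | ⟨h1, h3⟩⟩
    · exact Or.inl (Or.inl ⟨h1, m, n, h2, h3⟩)
    · exact Or.inl (Or.inr ⟨h1, m, n, h2, h3⟩)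
    · exact Or.inr ⟨h1, m, n, h2, h3⟩

theorem mem_add_zmul_add {A T : Set (Space l)} {P : (Fin l → ℝ) → Prop} {Q : ℤ → Prop} (i : ℤ)
    (hA : ∀ x, x ∈ A ↔ P x.1 ∧ x.2 = 0)
    (hT : ∀ x, x ∈ T ↔ ∃ m : ℤ, Q m ∧ x = (0, ((m : ℝ), 0))) (x : Space l) :
    x ∈ A + zmul i (b l) + T ↔
      P x.1 ∧ ∃ m n : ℤ, x.2 = ((m : ℝ), (n : ℝ)) ∧ Q m ∧ i ∣ n := by
  rw [add_assoc]
  exact mem_add_radical (Q := fun y => ∃ m n : ℤ, y = ((m : ℝ), (n : ℝ)) ∧ Q m ∧ i ∣ n) hA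
    (mem_zmul_b_add i hT) x

theorem reducedClassical_eq_model (X : AffineType) :
    reducedClassical l X = model l (fun _ _ => True) (fun _ n => X.middleStep ∣ n)
      (fun m n => Odd m ∧ X.longStep ∣ n) := by
  refine union_eq_model (fun x => ?_) (fun x => ?_) (fun x => ?_)
  · simpa [affShort] using mem_add_zmul_add 1 mem_bcShort_iff (mem_zmul_a 1) x
  · simpa [affMiddle] using mem_add_zmul_add X.middleStep mem_bcMiddle_iff (mem_zmul_a 1) x
  · exact mem_add_zmul_add X.longStep mem_bcLong_iff mem_oddA x

theorem BC11star_eq_model :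
    BC11star l = model l (fun _ _ => True) (fun _ _ => True) (fun m n => Odd m ∨ Odd n) := by
  refine union_eq_model (fun x => ?_) (fun x => ?_) (fun x => ?_)
  · simpa [affShort] using mem_add_zmul_add 1 mem_bcShort_iff (mem_zmul_a 1) x
  · simpa [affMiddle, AffineType.middleStep] using
      mem_add_zmul_add 1 mem_bcMiddle_iff (mem_zmul_a 1) x
  · exact mem_add_radical (Q := fun y => ∃ m n : ℤ, y = ((m : ℝ), (n : ℝ)) ∧ (Odd m ∨ Odd n))
      mem_bcLong_iff mem_L11 x

theorem BC44star_eq_model :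
    BC44star l = model l (fun m n => Odd m ∨ Odd n) (fun m n => 2 ∣ m ∧ 2 ∣ n)
      (fun m n => 4 ∣ m ∧ 4 ∣ n) := by
  refine union_eq_model (fun x => ?_) (fun x => ?_) (fun x => ?_)
  · exact mem_add_radical (Q := fun y => ∃ m n : ℤ, y = ((m : ℝ), (n : ℝ)) ∧ (Odd m ∨ Odd n))
      mem_bcShort_iff mem_L11 x
  · exact mem_add_zmul_add 2 mem_bcMiddle_iff (mem_zmul_a 2) x
  · exact mem_add_zmul_add 4 mem_bcLong_iff (mem_zmul_a 4) x

end ModelSets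

/-! ### Norms and coordinate sums of BC vectors -/

section Sums

variable {k : ℕ} {v : Fin k → ℝ}

theorem IsShortVec.dotProduct_self (hv : IsShortVec v) : v ⬝ᵥ v = 1 := by
  obtain ⟨i, σ, rfl | rfl, rfl⟩ := hv <;> simp

theorem IsMiddleVec.dotProduct_self (hv : IsMiddleVec v) : v ⬝ᵥ v = 2 := by
  obtain ⟨i, j, hij, σ, τ, rfl | rfl, rfl | rfl, rfl⟩ := hv <;> simp [hij, hij.symm] <;> norm_num

theorem IsLongVec.dotProduct_self (hv : IsLongVec v) : v ⬝ᵥ v = 4 := by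
  obtain ⟨i, σ, rfl | rfl, rfl⟩ := hv <;> simp <;> norm_num

/-- Adding a radical vector `c` to every frame vector moves the translation over `v` by the
coordinate sum of `v` times `c`. The residues here and in the next two lemmas show that, up to the
periods of `S`, `M` and `L`, this is `c`, 0 and `2c`. -/
theorem IsShortVec.sum_eq (hv : IsShortVec v) : ∃ n : ℤ, ∑ i, v i = n ∧ 2 ∣ n - 1 := by
  obtain ⟨i, σ, rfl | rfl, rfl⟩ := hv
  · exact ⟨1, by simp, by norm_num⟩
  · exact ⟨-1, by simp, by norm_num⟩

theorem IsMiddleVec.sum_eq (hv : IsMiddleVec v) : ∃ n : ℤ, ∑ i, v i = n ∧ 2 ∣ n := by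
  obtain ⟨i, j, hij, σ, τ, rfl | rfl, rfl | rfl, rfl⟩ := hv
  · exact ⟨2, by simp [Finset.sum_add_distrib]; norm_num, by norm_num⟩
  · exact ⟨0, by simp [Finset.sum_add_distrib], by norm_num⟩
  · exact ⟨0, by simp [Finset.sum_add_distrib], by norm_num⟩
  · exact ⟨-2, by simp [Finset.sum_add_distrib]; norm_num, by norm_num⟩

theorem IsLongVec.sum_eq (hv : IsLongVec v) : ∃ n : ℤ, ∑ i, v i = n ∧ 4 ∣ n - 2 := by
  obtain ⟨i, σ, rfl | rfl, rfl⟩ := hv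
  · exact ⟨2, by simp, by norm_num⟩
  · exact ⟨-2, by simp, by norm_num⟩

/-- If `v` and `2v` are both vectors of a system of type `BC`, then `v` is short and `2v` long. -/
theorem isShortVec_isLongVec_of_double {u v : Fin k → ℝ}
    (hv : IsShortVec v ∨ IsMiddleVec v ∨ IsLongVec v)
    (hu : IsShortVec u ∨ IsMiddleVec u ∨ IsLongVec u) (huv : u = (2 : ℝ) • v) :
    IsShortVec v ∧ IsLongVec u := by
  have h4 : u ⬝ᵥ u = 4 * (v ⬝ᵥ v) := by
    rw [huv, smul_dotProduct, dotProduct_smul, smul_eq_mul, smul_eq_mul]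
    ring
  rcases hv with hv | hv | hv <;> rcases hu with hu | hu | hu <;>
    rw [hv.dotProduct_self, hu.dotProduct_self] at h4 <;> norm_num at h4
  exact ⟨hv, hu⟩

end Sums

/-! ### Transport to the standard space -/

/-- The linear map with `ε_i ↦ e i`, `a ↦ x`, `b ↦ y`. -/
def frameMap {l : ℕ} (e : Fin l → F) (x y : F) : Space l →ₗ[ℝ] F :=
  (comb e).coprod ((LinearMap.toSpanSingleton ℝ F x).coprod (LinearMap.toSpanSingleton ℝ F y))

theorem frameMap_apply {l : ℕ} (e : Fin l → F) (x y : F) (z : Space l) :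
    frameMap e x y z = comb e z.1 + (z.2.1 • x + z.2.2 • y) := rfl

/-- The integral coordinates, along `a` and `b`, of the elements of `S`. -/
def intCoords (a b : F) (S : Set F) (m n : ℤ) : Prop := (m : ℝ) • a + (n : ℝ) • b ∈ S

theorem coords_unique {a b : F} (hli : LinearIndependent ℝ ![a, b]) {x y x' y' : ℝ}
    (h : x • a + y • b = x' • a + y' • b) : x = x' ∧ y = y' := by
  have h0 : (x - x') • a + (y - y') • b = 0 := by
    rw [← sub_eq_zero] at h
    rw [← h]
    module
  have := LinearIndependent.pair_iff.1 hli _ _ h0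
  exact ⟨sub_eq_zero.1 this.1, sub_eq_zero.1 this.2⟩

open IsSemidefRootSystem in
/-- An orthonormal family and a basis of the radical identify the standard space with `F`. -/
theorem frameMap_bijective [FiniteDimensional ℝ F] {J : LinearMap.BilinForm ℝ F} {R : Set F}
    (h : IsSemidefRootSystem J R) {l : ℕ} {e : Fin l → F} (he : IsOrthonormal J e)
    (hdim : Module.finrank ℝ F = l + 2) {x y : F} (hx : x ∈ rad J) (hy : y ∈ rad J)
    (hli : LinearIndependent ℝ ![x, y]) : Function.Bijective (frameMap e x y) := by
  have hinj : Function.Injective (frameMap e x y) := by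
    rw [← LinearMap.ker_eq_bot, LinearMap.ker_eq_bot']
    intro z hz
    rw [frameMap_apply] at hz
    have h1 : z.1 = 0 := by
      ext i
      have := congrArg (J (e i)) hz
      simpa [he.apply_comb, h.rad_right hx, h.rad_right hy] using this
    rw [h1, map_zero, zero_add] at hz
    have := LinearIndependent.pair_iff.1 hli _ _ hz
    exact Prod.ext h1 (Prod.ext this.1 this.2)
  refine ⟨hinj, ?_⟩
  refine (LinearMap.injective_iff_surjective_of_finrank_eq_finrank ?_).1 hinj
  rw [hdim]
  simp

open IsSemidefRootSystem in
theorem IsSemidefRootSystem.isOrthonormal_add_rad {J : LinearMap.BilinForm ℝ F} {R : Set F}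
    (h : IsSemidefRootSystem J R) {l : ℕ} {e : Fin l → F} (he : IsOrthonormal J e) {r : F}
    (hr : r ∈ rad J) : IsOrthonormal J fun i => e i + r := by
  intro i j
  simp only [map_add, LinearMap.add_apply, he i j, h.rad_right hr, mem_rad_iff.1 hr, add_zero]

open IsSemidefRootSystem in
theorem frameMap_isometry {J : LinearMap.BilinForm ℝ F} {R : Set F}
    (h : IsSemidefRootSystem J R) {l : ℕ} {e : Fin l → F} (he : IsOrthonormal J e) {x y : F}
    (hx : x ∈ rad J) (hy : y ∈ rad J) (u w : Space l) :
    J (frameMap e x y u) (frameMap e x y w) = form l u w := by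
  simp only [frameMap_apply, map_add, map_smul, LinearMap.add_apply, LinearMap.smul_apply,
    he.apply_comb_comb, h.rad_right hx, h.rad_right hy, mem_rad_iff.1 hx, mem_rad_iff.1 hy,
    form_apply]
  simp

namespace IsBCFibration

open IsSemidefRootSystem

variable {J : LinearMap.BilinForm ℝ F} {R : Set F} {l : ℕ} {e : Fin l → F} {S M L : Set F}

theorem comb_add_mem_iff (fb : IsBCFibration J R e S M L) (h : IsSemidefRootSystem J R)
    (hf : IsBCFrame J R e) {v : Fin l → ℝ} {r : F} (hr : r ∈ rad J) :
    comb e v + r ∈ R ↔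
      (IsShortVec v ∧ r ∈ S ∨ IsMiddleVec v ∧ r ∈ M ∨ IsLongVec v ∧ r ∈ L) := by
  constructor
  · intro hmem
    obtain ⟨u, hu, hur⟩ := hf.form _ hmem
    have huv : u = v := by
      ext i
      rw [← h.apply_of_sub_comb_mem hf.orthonormal hur i, map_add, hf.orthonormal.apply_comb,
        h.rad_right hr, add_zero]
    subst huv
    have hfib : r ∈ fibre J R e u := ⟨hr, hmem⟩
    rcases hu with hu | hu | hu
    · exact Or.inl ⟨hu, fb.short u hu ▸ hfib⟩
    · exact Or.inr (Or.inl ⟨hu, fb.middle u hu ▸ hfib⟩)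
    · exact Or.inr (Or.inr ⟨hu, fb.long u hu ▸ hfib⟩)
  · rintro (⟨hv, hrv⟩ | ⟨hv, hrv⟩ | ⟨hv, hrv⟩)
    · exact (fb.short v hv ▸ hrv : r ∈ fibre J R e v).2
    · exact (fb.middle v hv ▸ hrv : r ∈ fibre J R e v).2
    · exact (fb.long v hv ▸ hrv : r ∈ fibre J R e v).2

theorem isTranslationTriple (fb : IsBCFibration J R e S M L) (h : IsSemidefRootSystem J R)
    (hf : IsBCFrame J R e) (hl : 0 < l) (hred : IsReduced R) {a b : F}
    (hli : LinearIndependent ℝ ![a, b])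
    (hab : ∀ r, r ∈ Submodule.span ℤ S ↔ ∃ m n : ℤ, r = (m : ℝ) • a + (n : ℝ) • b)
    (hG : Submodule.span ℝ {a} ≤ rad J) {α β : F} (hα : α ∈ R) (hβ : β ∈ R)
    (hαβ : β - (2 : ℝ) • α ∈ Submodule.span ℝ {a}) :
    IsTranslationTriple (intCoords a b S) (intCoords a b M) (intCoords a b L) := by
  have cast_add : ∀ m n p q : ℤ, ((m + p : ℤ) : ℝ) • a + ((n + q : ℤ) : ℝ) • b =
      ((m : ℝ) • a + (n : ℝ) • b) + ((p : ℝ) • a + (q : ℝ) • b) := by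
    intro m n p q
    push_cast
    module
  have cast_mul : ∀ k m n : ℤ, ((k * m : ℤ) : ℝ) • a + ((k * n : ℤ) : ℝ) • b =
      (k : ℝ) • ((m : ℝ) • a + (n : ℝ) • b) := by
    intro k m n
    push_cast
    module
  -- Closure under `c • s` for `s` in `S`, with `S` stable under negation, extends to the whole
  -- lattice generated by `S`.
  have periodic : ∀ (T : Set F) (c : ℤ), (∀ x ∈ T, ∀ s ∈ S, x + (c : ℝ) • s ∈ T) →
      ∀ m n p q, intCoords a b T m n → intCoords a b T (m + c * p) (n + c * q) := by
    intro T c hT m n p q hmn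
    have hpq : (p : ℝ) • a + (q : ℝ) • b ∈ Submodule.span ℤ S := (hab _).2 ⟨p, q, rfl⟩
    have key : ∀ y ∈ Submodule.span ℤ S, ∀ x ∈ T, x + (c : ℝ) • y ∈ T ∧ x - (c : ℝ) • y ∈ T := by
      intro y hy
      induction hy using Submodule.span_induction with
      | mem y hy =>
        intro x hx
        refine ⟨hT x hx y hy, ?_⟩
        have := hT x hx _ (fb.neg_S y hy)
        rwa [smul_neg, ← sub_eq_add_neg] at this
      | zero => simp
      | add y z _ _ hy hz =>
        intro x hx
        constructor
        · rw [smul_add, ← add_assoc]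
          exact (hz _ (hy x hx).1).1
        · rw [smul_add, ← sub_sub]
          exact (hz _ (hy x hx).2).2
      | smul k y _ hy =>
        induction k using Int.induction_on with
        | zero => simp
        | succ k ih =>
          intro x hx
          constructor
          · convert (hy _ (ih x hx).1).1 using 1
            module
          · convert (hy _ (ih x hx).2).2 using 1
            module
        | pred k ih =>
          intro x hx
          constructor
          · convert (hy _ (ih x hx).1).2 using 1
            module
          · convert (hy _ (ih x hx).2).1 using 1
            module
    unfold intCoords
    rw [cast_add, cast_mul]
    exact (key _ hpq _ hmn).1
  refine
    { S_zero := by simpa [intCoords] using fb.zero_mem_S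
      M_zero := by simpa [intCoords] using fb.zero_mem_M
      S_two := periodic S 2 (by simpa using fb.S_add_S)
      M_two := periodic M 2 (by simpa using fb.M_add_S)
      L_four := periodic L 4 (by simpa using fb.L_add_S)
      S_add_M := fun m n p q h1 h2 => ?_
      S_add_L := fun m n p q h1 h2 => ?_
      M_add_L := fun m n p q h1 h2 => ?_
      L_add_M := fun m n p q h1 h2 => ?_
      L_add_L := fun m n p q h1 h2 => ?_
      reduced := fun m n h1 h2 => ?_
      generates := fun x y hxy => ?_
      nonreduced := ?_ }
  · unfold intCoords
    rw [cast_add]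
    exact fb.S_add_M _ h1 _ h2
  · unfold intCoords
    rw [cast_add]
    exact fb.S_add_L _ h1 _ h2
  · unfold intCoords
    rw [cast_add]
    exact fb.M_add_L _ h1 _ h2
  · unfold intCoords
    rw [cast_add, cast_mul]
    simpa using fb.L_add_M _ h1 _ h2
  · unfold intCoords
    rw [cast_add, cast_mul]
    simpa using fb.L_add_L _ h1 _ h2
  · unfold intCoords at h1 h2
    rw [cast_mul] at h2
    set r := (m : ℝ) • a + (n : ℝ) • b
    let o : Fin l := ⟨0, hl⟩
    have hr : r ∈ rad J := fb.S_subset_rad hl h1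
    have hs : comb e (Pi.single o 1) + r ∈ R :=
      (fb.comb_add_mem_iff h hf hr).2 (Or.inl ⟨⟨o, 1, Or.inl rfl, rfl⟩, h1⟩)
    have hL : comb e (Pi.single o (2 * 1)) + (2 : ℝ) • r ∈ R :=
      (fb.comb_add_mem_iff h hf ((rad J).smul_mem 2 hr)).2
        (Or.inr (Or.inr ⟨⟨o, 1, Or.inl rfl, rfl⟩, by simpa using h2⟩))
    refine (hred _ hs).1 ?_
    convert hL using 1
    rw [comb_single, comb_single]
    module
  -- Otherwise the whole span of `S`, including the basis vectors `a` and `b`, would lie in the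
  -- kernel of a non-zero form modulo 2.
  · by_contra! hcon
    have key : ∀ r ∈ Submodule.span ℤ S, ∃ m n : ℤ, r = (m : ℝ) • a + (n : ℝ) • b ∧
        Even (x * m + y * n) := by
      intro r hr
      induction hr using Submodule.span_induction with
      | mem r hr =>
        obtain ⟨m, n, rfl⟩ := (hab r).1 (Submodule.subset_span hr)
        exact ⟨m, n, rfl, Int.not_odd_iff_even.1 (hcon m n hr)⟩
      | zero => exact ⟨0, 0, by simp, by simp⟩
      | add r s _ _ hr hs =>
        obtain ⟨m, n, rfl, h1⟩ := hr
        obtain ⟨p, q, rfl, h2⟩ := hs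
        refine ⟨m + p, n + q, (cast_add _ _ _ _).symm, ?_⟩
        rw [show x * (m + p) + y * (n + q) = (x * m + y * n) + (x * p + y * q) by ring]
        exact h1.add h2
      | smul k r _ hr =>
        obtain ⟨m, n, rfl, h1⟩ := hr
        refine ⟨k * m, k * n, ?_, ?_⟩
        · rw [cast_mul, Int.cast_smul_eq_zsmul ℝ k]
        · rw [show x * (k * m) + y * (k * n) = k * (x * m + y * n) by ring]
          exact h1.mul_left k
    rcases hxy with hx | hy
    · obtain ⟨m, n, hmn, hev⟩ := key a ((hab a).2 ⟨1, 0, by simp⟩)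
      have := coords_unique hli (x := 1) (y := 0) (x' := m) (y' := n) (by simpa using hmn)
      have hm : m = 1 := by exact_mod_cast this.1.symm
      have hn : n = 0 := by exact_mod_cast this.2.symm
      subst hm hn
      rw [← Int.not_odd_iff_even] at hev
      exact hev (by simpa using hx)
    · obtain ⟨m, n, hmn, hev⟩ := key b ((hab b).2 ⟨0, 1, by simp⟩)
      have := coords_unique hli (x := 0) (y := 1) (x' := m) (y' := n) (by simpa using hmn)
      have hm : m = 0 := by exact_mod_cast this.1.symm
      have hn : n = 1 := by exact_mod_cast this.2.symm
      subst hm hn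
      rw [← Int.not_odd_iff_even] at hev
      exact hev (by simpa using hy)
  -- Doubling in the quotient forces `α` short and `β` long. As `β - 2α` is a multiple of `a`, the
  -- `b`-coordinate of the translation of `β` is twice that of `α`.
  · obtain ⟨v, hv, hαv⟩ := hf.form α hα
    obtain ⟨u, hu, hβu⟩ := hf.form β hβ
    have huv : u = (2 : ℝ) • v := by
      ext i
      have h1 := h.rad_right (hG hαβ) (e i)
      rw [map_sub, map_smul, h.apply_of_sub_comb_mem hf.orthonormal hαv,
        h.apply_of_sub_comb_mem hf.orthonormal hβu] at h1
      rw [Pi.smul_apply]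
      linarith
    obtain ⟨hvs, hul⟩ := isShortVec_isLongVec_of_double hv hu huv
    have hαS : α - comb e v ∈ S := by
      rw [← fb.short v hvs]
      exact ⟨hαv, by simpa using hα⟩
    have hβL : β - comb e u ∈ L := by
      rw [← fb.long u hul]
      exact ⟨hβu, by simpa using hβ⟩
    obtain ⟨p, q, hpq⟩ := (hab _).1 (Submodule.subset_span hαS)
    obtain ⟨m, n, hmn⟩ := (hab _).1 (Submodule.subset_span (fb.L_subset hβL))
    obtain ⟨t, ht⟩ := Submodule.mem_span_singleton.1 hαβ
    have heq : (m : ℝ) • a + (n : ℝ) • b = (2 * p + t) • a + (2 * q : ℝ) • b := by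
      have h1 : β - comb e u = (2 : ℝ) • (α - comb e v) + (β - (2 : ℝ) • α) := by
        rw [huv, map_smul]
        module
      rw [hmn, hpq, ← ht] at h1
      rw [h1]
      module
    have hn : n = 2 * q := by exact_mod_cast (coords_unique hli heq).2
    refine ⟨m, p, q, ?_, ?_⟩
    · unfold intCoords
      rw [← hn, ← hmn]
      exact hβL
    · unfold intCoords
      rw [← hpq]
      exact hαS

/-- Moving the frame by `c` realises the shift of origin in `HasNormalForm`: the true displacement
is the coordinate sum times `c`, and its difference from `c`, 0 or `2c` is absorbed by the
congruence lemmas. -/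
theorem frameMap_mem_iff (fb : IsBCFibration J R e S M L) (h : IsSemidefRootSystem J R)
    (hf : IsBCFrame J R e) {a b : F} (hli : LinearIndependent ℝ ![a, b])
    (ha : a ∈ rad J) (hb : b ∈ rad J)
    (hab : ∀ r, r ∈ Submodule.span ℤ S → ∃ m n : ℤ, r = (m : ℝ) • a + (n : ℝ) • b)
    (tr : IsTranslationTriple (intCoords a b S) (intCoords a b M) (intCoords a b L))
    {S₀ M₀ L₀ : ℤ → ℤ → Prop} {c₁ c₂ t : ℤ}
    (hnf : ∀ m n, (intCoords a b S (m + t * n + c₁) (n + c₂) ↔ S₀ m n) ∧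
      (intCoords a b M (m + t * n) n ↔ M₀ m n) ∧
      (intCoords a b L (m + t * n + 2 * c₁) (n + 2 * c₂) ↔ L₀ m n)) (z : Space l) :
    frameMap (fun i => e i + ((c₁ : ℝ) • a + (c₂ : ℝ) • b)) a (b + (t : ℝ) • a) z ∈ R ↔
      z ∈ model l S₀ M₀ L₀ := by
  obtain ⟨v, x, y⟩ := z
  set c : F := (c₁ : ℝ) • a + (c₂ : ℝ) • b with hc
  have hcomb : comb (fun i => e i + c) v = comb e v + (∑ i, v i) • c := by
    simp [comb, Fintype.linearCombination_apply, Finset.sum_add_distrib, Finset.sum_smul]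
  set σ : ℝ := ∑ i, v i with hσ
  have hz : frameMap (fun i => e i + c) a (b + (t : ℝ) • a) (v, x, y) =
      comb e v + ((x + t * y + σ * c₁) • a + (y + σ * c₂) • b) := by
    rw [frameMap_apply, hcomb, hc]
    module
  have hr : ∀ p q : ℝ, p • a + q • b ∈ rad J := fun p q =>
    (rad J).add_mem ((rad J).smul_mem _ ha) ((rad J).smul_mem _ hb)
  have hcoord : ∀ T ⊆ S, ∀ s : ℤ, σ = s →
      ((x + t * y + σ * c₁) • a + (y + σ * c₂) • b ∈ T ↔
        ∃ m n : ℤ, (x, y) = ((m : ℝ), (n : ℝ)) ∧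
          intCoords a b T (m + t * n + s * c₁) (n + s * c₂)) := by
    intro T hT s hs
    constructor
    · intro hmem
      obtain ⟨m, n, hmn⟩ := hab _ (Submodule.subset_span (hT hmem))
      obtain ⟨h1, h2⟩ := coords_unique hli hmn
      rw [hs] at h1 h2
      have hy : y = ((n - s * c₂ : ℤ) : ℝ) := by
        push_cast
        linarith
      have hx : x = ((m - s * c₁ - t * (n - s * c₂) : ℤ) : ℝ) := by
        rw [hy] at h1
        push_cast at h1 ⊢
        linarith
      refine ⟨_, _, Prod.ext hx hy, ?_⟩
      rw [hmn] at hmem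
      unfold intCoords
      convert hmem using 4 <;> ring
    · rintro ⟨m, n, hxy, hmem⟩
      obtain ⟨rfl, rfl⟩ := Prod.ext_iff.1 hxy
      unfold intCoords at hmem
      convert hmem using 3
      · rw [hs]
        push_cast
        ring
      · rw [hs]
        push_cast
        ring
  rw [hz, fb.comb_add_mem_iff h hf (hr _ _)]
  have hshort : IsShortVec v → ((x + t * y + σ * c₁) • a + (y + σ * c₂) • b ∈ S ↔
      ∃ m n : ℤ, (x, y) = ((m : ℝ), (n : ℝ)) ∧ S₀ m n) := by
    intro hv
    obtain ⟨s, hs, ⟨w, hw⟩⟩ := hv.sum_eq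
    obtain rfl : s = 1 + 2 * w := by omega
    rw [hcoord S subset_rfl _ hs]
    refine exists_congr fun m => exists_congr fun n => and_congr_right fun _ => ?_
    rw [← (hnf m n).1]
    constructor
    · exact tr.S_congr ⟨-(w * c₁), by ring⟩ ⟨-(w * c₂), by ring⟩
    · exact tr.S_congr ⟨w * c₁, by ring⟩ ⟨w * c₂, by ring⟩
  have hmiddle : IsMiddleVec v → ((x + t * y + σ * c₁) • a + (y + σ * c₂) • b ∈ M ↔
      ∃ m n : ℤ, (x, y) = ((m : ℝ), (n : ℝ)) ∧ M₀ m n) := by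
    intro hv
    obtain ⟨s, hs, ⟨w, rfl⟩⟩ := hv.sum_eq
    rw [hcoord M fb.M_subset _ hs]
    refine exists_congr fun m => exists_congr fun n => and_congr_right fun _ => ?_
    rw [← (hnf m n).2.1]
    constructor
    · exact tr.M_congr ⟨-(w * c₁), by ring⟩ ⟨-(w * c₂), by ring⟩
    · exact tr.M_congr ⟨w * c₁, by ring⟩ ⟨w * c₂, by ring⟩
  have hlong : IsLongVec v → ((x + t * y + σ * c₁) • a + (y + σ * c₂) • b ∈ L ↔
      ∃ m n : ℤ, (x, y) = ((m : ℝ), (n : ℝ)) ∧ L₀ m n) := by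
    intro hv
    obtain ⟨s, hs, ⟨w, hw⟩⟩ := hv.sum_eq
    obtain rfl : s = 2 + 4 * w := by omega
    rw [hcoord L fb.L_subset _ hs]
    refine exists_congr fun m => exists_congr fun n => and_congr_right fun _ => ?_
    rw [← (hnf m n).2.2]
    constructor
    · exact tr.L_congr ⟨-(w * c₁), by ring⟩ ⟨-(w * c₂), by ring⟩
    · exact tr.L_congr ⟨w * c₁, by ring⟩ ⟨w * c₂, by ring⟩
  rw [and_congr_right hshort, and_congr_right hmiddle, and_congr_right hlong]
  constructor
  · rintro (⟨h1, m, n, h2, h3⟩ | ⟨h1, m, n, h2, h3⟩ | ⟨h1, m, n, h2, h3⟩)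
    · exact ⟨m, n, h2, Or.inl ⟨h1, h3⟩⟩
    · exact ⟨m, n, h2, Or.inr (Or.inl ⟨h1, h3⟩)⟩
    · exact ⟨m, n, h2, Or.inr (Or.inr ⟨h1, h3⟩)⟩
  · rintro ⟨m, n, h2, ⟨h1, h3⟩ | ⟨h1, h3⟩ | ⟨h1, h3⟩⟩
    · exact Or.inl ⟨h1, m, n, h2, h3⟩
    · exact Or.inr (Or.inl ⟨h1, m, n, h2, h3⟩)
    · exact Or.inr (Or.inr ⟨h1, m, n, h2, h3⟩)

theorem markedIsoTo_model [FiniteDimensional ℝ F] {I : LinearMap.BilinForm ℝ F} {c : ℝ}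
    (hc : 0 < c) (fb : IsBCFibration (c • I) R e S M L) (h : IsSemidefRootSystem (c • I) R)
    (hf : IsBCFrame (c • I) R e) (hdim : Module.finrank ℝ F = l + 2) {a b : F}
    (hli : LinearIndependent ℝ ![a, b]) (ha : a ∈ rad (c • I)) (hb : b ∈ rad (c • I))
    (hab : ∀ r, r ∈ Submodule.span ℤ S → ∃ m n : ℤ, r = (m : ℝ) • a + (n : ℝ) • b)
    (tr : IsTranslationTriple (intCoords a b S) (intCoords a b M) (intCoords a b L))
    {S₀ M₀ L₀ : ℤ → ℤ → Prop}
    (hnf : HasNormalForm (intCoords a b S) (intCoords a b M) (intCoords a b L) S₀ M₀ L₀) :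
    MarkedIsoTo I R (Submodule.span ℝ {a}) l (model l S₀ M₀ L₀) := by
  obtain ⟨c₁, c₂, t, hnf⟩ := hnf
  set e' : Fin l → F := fun i => e i + ((c₁ : ℝ) • a + (c₂ : ℝ) • b) with he'
  set b' : F := b + (t : ℝ) • a with hb'
  have hcr : (c₁ : ℝ) • a + (c₂ : ℝ) • b ∈ rad (c • I) :=
    (rad _).add_mem ((rad _).smul_mem _ ha) ((rad _).smul_mem _ hb)
  have hbr : b' ∈ rad (c • I) := (rad _).add_mem hb ((rad _).smul_mem _ ha)
  have horth : IsOrthonormal (c • I) e' := h.isOrthonormal_add_rad hf.orthonormal hcr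
  have hli' : LinearIndependent ℝ ![a, b'] := by
    rw [LinearIndependent.pair_iff] at hli ⊢
    intro p q hpq
    have := hli (p + q * t) q (by rw [← hpq, hb']; module)
    refine ⟨?_, this.2⟩
    rw [this.2] at this
    simpa using this.1
  have hbij := frameMap_bijective h horth hdim ha hbr hli'
  let ψ : Space l ≃ₗ[ℝ] F := LinearEquiv.ofBijective (frameMap e' a b') hbij
  have hmem : ∀ z, ψ z ∈ R ↔ z ∈ model l S₀ M₀ L₀ :=
    fb.frameMap_mem_iff h hf hli ha hb hab tr hnf
  refine ⟨ψ.symm, ⟨?_, c, hc, fun x y => ?_⟩, ?_⟩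
  · ext z
    rw [← hmem]
    constructor
    · rintro ⟨x, hx, rfl⟩
      simpa using hx
    · intro hz
      exact ⟨ψ z, hz, by simp⟩
  · have := frameMap_isometry h horth ha hbr (ψ.symm x) (ψ.symm y)
    rw [← this]
    change (c • I) (ψ (ψ.symm x)) (ψ (ψ.symm y)) = _
    simp
  · rw [Submodule.map_span, Set.image_singleton, markingA]
    congr 2
    change ψ.symm a = _
    rw [LinearEquiv.symm_apply_eq]
    change a = frameMap e' a b' _
    rw [frameMap_apply]
    simp [EllipticRoot.a]

end IsBCFibration

/-! ### The classification for a given marking -/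

theorem rad_smul (I : LinearMap.BilinForm ℝ F) {c : ℝ} (hc : c ≠ 0) : rad (c • I) = rad I := by
  ext x
  simp only [rad, LinearMap.mem_ker, LinearMap.smul_apply, smul_eq_zero, hc, false_or]

theorem exists_sub_two_smul_mem {R : Set F} {G : Submodule ℝ F}
    (h : ¬ IsReduced (quotientSystem R G)) : ∃ α ∈ R, ∃ β ∈ R, β - (2 : ℝ) • α ∈ G := by
  unfold IsReduced at h
  push Not at h
  obtain ⟨x, ⟨α, hα, rfl⟩, hx⟩ := h
  by_cases h2 : (2 : ℝ) • G.mkQ α ∈ quotientSystem R G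
  · obtain ⟨β, hβ, hαβ⟩ := h2
    refine ⟨α, hα, β, hβ, ?_⟩
    rw [← Submodule.ker_mkQ G, LinearMap.mem_ker, map_sub, map_smul, hαβ, sub_self]
  · obtain ⟨β, hβ, hαβ⟩ := hx h2
    refine ⟨β, hβ, α, hα, ?_⟩
    rw [← Submodule.ker_mkQ G, LinearMap.mem_ker, map_sub, map_smul, hαβ, smul_smul]
    norm_num

theorem isReduced_quotientSystem {R : Set F} {G : Submodule ℝ F}
    (h : ∀ α ∈ R, ∀ β ∈ R, β - (2 : ℝ) • α ∉ G) : IsReduced (quotientSystem R G) := by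
  by_contra hcon
  obtain ⟨α, hα, β, hβ, hαβ⟩ := exists_sub_two_smul_mem hcon
  exact h α hα β hβ hαβ

theorem IsMarking.exists_ne_zero {I : LinearMap.BilinForm ℝ F} {R : Set F} {G : Submodule ℝ F}
    (hG : IsMarking I R G) : ∃ g ∈ G, g ≠ 0 ∧ g ∈ rootLattice R := by
  by_contra! hcon
  have h1 : Submodule.span ℝ ((G : Set F) ∩ (rootLattice R : Set F)) = ⊥ := by
    rw [Submodule.span_eq_bot]
    rintro x ⟨hx, hxR⟩
    by_contra hx0
    exact hcon x hx hx0 hxR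
  have h2 := hG.finrank_eq
  rw [← hG.full, h1] at h2
  simp at h2

theorem model_eq_of_lt_two {l : ℕ} (hl : l < 2) (S M M' L : ℤ → ℤ → Prop) :
    model l S M L = model l S M' L := by
  have : ∀ v : Fin l → ℝ, ¬ IsMiddleVec v := by
    rintro v ⟨i, j, hij, -⟩
    exact hij (Fin.ext (by omega))
  ext x
  simp [model, this]

theorem IsElliptic.span_eq_top {I : LinearMap.BilinForm ℝ F} {l : ℕ} {R : Set F}
    (hR : IsElliptic I l R) : Submodule.span ℝ R = ⊤ := by
  rw [← hR.rootSystem.full, rootLattice, Submodule.span_span_of_tower]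

/-- The classification of the reduced marked systems with non-reduced quotient. -/
theorem IsElliptic.markedIsoTo {I : LinearMap.BilinForm ℝ F} {l : ℕ} {R : Set F}
    (hR : IsElliptic I l R) (hred : IsReduced R) {G : Submodule ℝ F} (hG : IsMarking I R G)
    (hnr : ¬ IsReduced (quotientSystem R G)) :
    MarkedIsoTo I R G l (BC12 l) ∨ MarkedIsoTo I R G l (BC11star l) ∨
      MarkedIsoTo I R G l (BC42 l) ∨ MarkedIsoTo I R G l (BC44star l) ∨
      MarkedIsoTo I R G l (BC22σ2 l) ∨ (2 ≤ l ∧ MarkedIsoTo I R G l (BC22σ1 l)) := by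
  have hfd : FiniteDimensional ℝ F :=
    Module.finite_of_finrank_pos (by rw [hR.finrank_space]; omega)
  obtain ⟨α, hα, β, hβ, hαβ⟩ := exists_sub_two_smul_mem hnr
  have hI := hR.isSemidefRootSystem
  have hαpos := hI.pos α hα
  -- The form is normalised so that the root doubled in the quotient has length one; the scalar
  -- reappears in the isomorphism.
  obtain ⟨c, hc, hcα⟩ : ∃ c : ℝ, 0 < c ∧ c * I α α = 1 :=
    ⟨(I α α)⁻¹, inv_pos.2 hαpos, inv_mul_cancel₀ hαpos.ne'⟩
  have h := hI.smul hc
  have hrad := rad_smul I hc.ne'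
  have hspan := hR.span_eq_top
  have hd : IsSemidefRootSystem.IsDoubled (c • I) R α :=
    ⟨hα, by simpa using hcα, β, hβ, by rw [hrad]; exact hG.le_rad hαβ⟩
  obtain ⟨k, e, hk, hf⟩ := h.exists_isBCFrame hd
  have hkl := hf.card_add_finrank_rad h hspan
  rw [hrad, hR.finrank_rad, hR.finrank_space] at hkl
  obtain rfl : k = l := by omega
  obtain ⟨S, M, L, fb⟩ := hf.exists_fibration h hk
  obtain ⟨g, hgG, hg0, hgR⟩ := hG.exists_ne_zero
  have hSspan := fb.span_S h hf hk hspan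
  have hSle : Submodule.span ℤ S ≤ rootLattice R :=
    Submodule.span_le.2 (fb.S_subset_rootLattice hk)
  have hdisc : DiscreteTopology (Submodule.span ℤ S) := by
    have := hR.rootSystem.lattice
    exact DiscreteTopology.of_subset (s := (rootLattice R : Set F)) this hSle
  have hgS := fb.rootLattice_inter_rad h hf hk hgR (by rw [hrad]; exact hG.le_rad hgG)
  obtain ⟨a, b, hli, hab, haG, hcoord⟩ := exists_adapted_basis hdisc
    (by rw [hSspan, hrad, hR.finrank_rad]) hG.finrank_eq hgG hg0 hgS
  rw [hSspan] at hab
  have ha : a ∈ rad (c • I) := hab ▸ Submodule.subset_span (by simp)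
  have hb : b ∈ rad (c • I) := hab ▸ Submodule.subset_span (by simp)
  subst haG
  have tr := fb.isTranslationTriple h hf hk hred hli hcoord (by rw [hrad]; exact hG.le_rad) hα hβ hαβ
  have iso := fun {S₀ M₀ L₀ : ℤ → ℤ → Prop} => fb.markedIsoTo_model (S₀ := S₀) (M₀ := M₀)
    (L₀ := L₀) hc h hf hR.finrank_space hli ha hb (fun r => (hcoord r).1) tr
  simp only [BC12, BC42, BC22σ1, BC22σ2, reducedClassical_eq_model, BC11star_eq_model,
    BC44star_eq_model, AffineType.middleStep, AffineType.longStep, one_dvd, and_true]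
  rcases tr.normalForm with hn | hn | hn | hn | hn | hn
  · exact Or.inl (iso hn)
  · exact Or.inr (Or.inl (iso hn))
  · exact Or.inr (Or.inr (Or.inl (iso hn)))
  · exact Or.inr (Or.inr (Or.inr (Or.inl (iso hn))))
  · exact Or.inr (Or.inr (Or.inr (Or.inr (Or.inl (iso hn)))))
  -- In rank one the two `(2,2)σ` systems differ only in their absent middle roots and coincide.
  · by_cases hl : 2 ≤ k
    · exact Or.inr (Or.inr (Or.inr (Or.inr (Or.inr ⟨hl, iso hn⟩))))
    · refine Or.inr (Or.inr (Or.inr (Or.inr (Or.inl ?_))))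
      rw [model_eq_of_lt_two (by omega) _ _ (fun _ _ => True)]
      exact iso hn

/-! ### Existence of markings and the second assertion -/

/-- The root lattice of an elliptic root system meets the radical: the integral matrix of the
pairings `I(β_i^∨, β_j)`, for a basis of roots `β_i`, is singular. -/
theorem IsElliptic.exists_rootLattice_mem_rad {I : LinearMap.BilinForm ℝ F} {l : ℕ} {R : Set F}
    (hR : IsElliptic I l R) : ∃ g ∈ rad I, g ≠ 0 ∧ g ∈ rootLattice R := by
  have hfd : FiniteDimensional ℝ F :=
    Module.finite_of_finrank_pos (by rw [hR.finrank_space]; omega)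
  obtain ⟨B, hBR, hBspan, hBli⟩ := exists_linearIndependent ℝ R
  rw [hR.span_eq_top] at hBspan
  have : Fintype B := (hBli.setFinite).fintype
  classical
  have hN : ∀ i j : B, ∃ n : ℤ, I (coroot I i) j = n := fun i j =>
    hR.rootSystem.integral i (hBR i.2) j (hBR j.2)
  choose N hN using hN
  have hpair : ∀ (i : B) (x : B → ℝ), I (coroot I i) (∑ j, x j • (j : F)) = ∑ j, N i j * x j := by
    intro i x
    simp [hN, mul_comm]
  obtain ⟨z, hz0⟩ : ∃ z : rad I, z ≠ 0 := by
    have : Nontrivial (rad I) := Module.nontrivial_of_finrank_pos (R := ℝ)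
      (by rw [hR.finrank_rad]; norm_num)
    exact exists_ne 0
  have hsymm := hR.isSemidefRootSystem
  have hz : ∀ y, I y z = 0 := hsymm.rad_right z.2
  -- The coordinates of a non-zero radical vector form a real kernel vector. The determinant
  -- therefore vanishes, and being an integer it yields an integral kernel vector as well.
  have hdet : (Matrix.of N).det = 0 := by
    have hmap : ((Matrix.of N).map (Int.castRingHom ℝ)).det = 0 := by
      rw [← Matrix.exists_mulVec_eq_zero_iff]
      have hzB : (z : F) ∈ Submodule.span ℝ (Set.range (Subtype.val : B → F)) := by
        rw [Subtype.range_coe, hBspan]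
        exact Submodule.mem_top
      obtain ⟨x, hx⟩ := (Submodule.mem_span_range_iff_exists_fun ℝ).1 hzB
      refine ⟨x, ?_, ?_⟩
      · rintro rfl
        apply hz0
        ext
        simpa using hx.symm
      · ext i
        have := hpair i x
        rw [hx, hz] at this
        simpa [Matrix.mulVec, dotProduct] using this.symm
    rw [← RingHom.mapMatrix_apply, ← RingHom.map_det] at hmap
    rw [eq_intCast] at hmap
    exact_mod_cast hmap
  obtain ⟨y, hy0, hy⟩ := Matrix.exists_mulVec_eq_zero_iff.2 hdet
  refine ⟨∑ j, (y j : ℝ) • (j : F), ?_, ?_, ?_⟩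
  · have key : ∀ x, I x (∑ j, (y j : ℝ) • (j : F)) = 0 := by
      intro x
      have hx : x ∈ Submodule.span ℝ B := hBspan ▸ Submodule.mem_top
      induction hx using Submodule.span_induction with
      | mem x hx =>
        have h1 := hpair ⟨x, hx⟩ (fun j => (y j : ℝ))
        have h2 : ∑ j, (N ⟨x, hx⟩ j : ℝ) * (y j : ℝ) = 0 := by
          have := congrFun hy ⟨x, hx⟩
          simp only [Matrix.mulVec, dotProduct, Matrix.of_apply, Pi.zero_apply] at this
          exact_mod_cast this
        rw [h2, coroot, map_smul, LinearMap.smul_apply, smul_eq_mul] at h1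
        refine (mul_eq_zero.1 h1).resolve_left ?_
        exact div_ne_zero two_ne_zero (hR.rootSystem.nonisotropic x (hBR hx))
      | zero => simp
      | add u v _ _ hu hv => rw [map_add, LinearMap.add_apply, hu, hv, add_zero]
      | smul t u _ hu => rw [map_smul, LinearMap.smul_apply, hu, smul_zero]
    exact IsSemidefRootSystem.mem_rad_iff.2 fun x => by rw [hsymm.symm, key]
  · intro h0
    apply hy0
    ext j
    have := Fintype.linearIndependent_iff.1 hBli (fun j => (y j : ℝ)) h0 j
    exact_mod_cast this
  · refine Submodule.sum_mem _ fun j _ => ?_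
    rw [Int.cast_smul_eq_zsmul]
    exact Submodule.smul_mem _ _ (Submodule.subset_span (hBR j.2))

theorem isMarking_span_singleton {I : LinearMap.BilinForm ℝ F} {R : Set F} {g : F}
    (hg : g ∈ rad I) (hg0 : g ≠ 0) (hgR : g ∈ rootLattice R) :
    IsMarking I R (Submodule.span ℝ {g}) where
  le_rad := by simpa using hg
  finrank_eq := finrank_span_singleton hg0
  full := by
    apply le_antisymm
    · exact Submodule.span_le.2 Set.inter_subset_left
    · rw [Submodule.span_singleton_le_iff_mem]
      exact Submodule.subset_span ⟨Submodule.mem_span_singleton_self g, hgR⟩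

/-- The systems with long roots translated by odd multiples of `a` have reduced quotient for the
marking `ℝb`. -/
theorem exists_reduced_marking {I : LinearMap.BilinForm ℝ F} {l : ℕ} {R : Set F}
    (hR : IsElliptic I l R) {X : AffineType} (hiso : IsoTo I R l (reducedClassical l X)) :
    ∃ G : Submodule ℝ F, IsMarking I R G ∧ IsReduced (quotientSystem R G) := by
  obtain ⟨φ, hφR, c, hc, hφ⟩ := hiso
  rw [reducedClassical_eq_model] at hφR
  have hmem : ∀ z, φ.symm z ∈ R ↔ z ∈ model l (fun _ _ => True) (fun _ n => X.middleStep ∣ n)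
      (fun m n => Odd m ∧ X.longStep ∣ n) := by
    intro z
    rw [← hφR]
    constructor
    · intro hz
      exact ⟨_, hz, by simp⟩
    · rintro ⟨x, hx, rfl⟩
      simpa using hx
  have hl : 0 < l := by
    obtain ⟨x, hx⟩ := hR.rootSystem.nonempty
    have : φ x ∈ model l (fun _ _ => True) (fun _ n => X.middleStep ∣ n)
      (fun m n => Odd m ∧ X.longStep ∣ n) := by
      rw [← hmem]
      simpa using hx
    obtain ⟨m, n, -, ⟨⟨i, -⟩, -⟩ | ⟨⟨i, -⟩, -⟩ | ⟨⟨i, -⟩, -⟩⟩ := this <;> exact i.pos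
  refine ⟨Submodule.span ℝ {φ.symm (b l)}, isMarking_span_singleton ?_ ?_ ?_,
    isReduced_quotientSystem fun α hα β hβ hαβ => ?_⟩
  · refine IsSemidefRootSystem.mem_rad_iff.2 fun y => ?_
    have h1 := hφ (φ.symm (b l)) y
    have h2 : form l (φ (φ.symm (b l))) (φ y) = 0 := by
      rw [form_apply]
      simp [b]
    rw [h2] at h1
    exact (mul_eq_zero.1 h1.symm).resolve_left hc.ne'
  · rw [Ne, LinearEquiv.map_eq_zero_iff]
    simp [b]
  -- The vector `b` is the difference of the short roots `ε_o + b` and `ε_o`, so it lies in the root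
  -- lattice.
  · let o : Fin l := ⟨0, hl⟩
    have h1 : φ.symm (ε l o) ∈ R :=
      (hmem _).2 ⟨0, 0, by simp [ε, Prod.zero_eq_mk], Or.inl ⟨⟨o, 1, Or.inl rfl, rfl⟩, trivial⟩⟩
    have h2 : φ.symm (ε l o + b l) ∈ R :=
      (hmem _).2 ⟨0, 1, by simp [ε, b], Or.inl ⟨⟨o, 1, Or.inl rfl, by simp [ε, b]⟩, trivial⟩⟩
    have := (rootLattice R).sub_mem (Submodule.subset_span h2) (Submodule.subset_span h1)
    simpa using this
  · have hα' := (hmem (φ α)).1 (by simpa using hα)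
    have hβ' := (hmem (φ β)).1 (by simpa using hβ)
    obtain ⟨t, ht⟩ := Submodule.mem_span_singleton.1 hαβ
    have heq : φ β = (2 : ℝ) • φ α + t • b l := by
      have := congrArg φ ht
      rw [map_smul, LinearEquiv.apply_symm_apply, map_sub, map_smul] at this
      rw [this]
      module
    have hv : (φ β).1 = (2 : ℝ) • (φ α).1 := by
      rw [heq]
      simp [b]
    have hx : (φ β).2.1 = 2 * (φ α).2.1 := by
      rw [heq]
      simp [b]
    obtain ⟨m, n, hmn, hα'⟩ := hα'
    obtain ⟨p, q, hpq, hβ'⟩ := hβ'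
    -- A doubling modulo `ℝb` preserves the `a`-coordinate: it is odd for the long root `β`, yet
    -- twice that of `α`.
    have hlong := (isShortVec_isLongVec_of_double (hα'.imp And.left (Or.imp And.left And.left))
      (hβ'.imp And.left (Or.imp And.left And.left)) hv).2
    have hodd : Odd p := by
      rcases hβ' with ⟨h1, -⟩ | ⟨h1, -⟩ | ⟨-, h1, -⟩
      · have := h1.dotProduct_self.symm.trans hlong.dotProduct_self
        norm_num at this
      · have := h1.dotProduct_self.symm.trans hlong.dotProduct_self
        norm_num at this
      · exact h1
    rw [hpq, hmn] at hx
    dsimp only at hx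
    have hx' : p = 2 * m := by exact_mod_cast hx
    rw [hx', Int.odd_iff] at hodd
    omega

end EllipticRoot

end

open EllipticRoot in
theorem mainTheorem2 {F : Type*} [NormedAddCommGroup F] [NormedSpace ℝ F]
    (I : LinearMap.BilinForm ℝ F) (l : ℕ) (R : Set F)
    (hR : IsElliptic I l R) (hred : IsReduced R) :
    (∀ G : Submodule ℝ F, IsMarking I R G → ¬ IsReduced (quotientSystem R G) →
      MarkedIsoTo I R G l (BC12 l) ∨ MarkedIsoTo I R G l (BC11star l) ∨
      MarkedIsoTo I R G l (BC42 l) ∨ MarkedIsoTo I R G l (BC44star l) ∨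
      MarkedIsoTo I R G l (BC22σ2 l) ∨ (2 ≤ l ∧ MarkedIsoTo I R G l (BC22σ1 l))) ∧
    ((∃ G : Submodule ℝ F, IsMarking I R G ∧ IsReduced (quotientSystem R G)) ∨
      IsoTo I R l (BC11star l) ∨ IsoTo I R l (BC44star l)) := by
  refine ⟨fun G hG hnr => hR.markedIsoTo hred hG hnr, ?_⟩
  -- Any marking will do as a start: either its quotient is reduced, or the first assertion puts `R`
  -- in one of the six families.
  obtain ⟨g, hg, hg0, hgR⟩ := hR.exists_rootLattice_mem_rad
  have hG := isMarking_span_singleton hg hg0 hgR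
  by_cases hq : IsReduced (quotientSystem R (Submodule.span ℝ {g}))
  · exact Or.inl ⟨_, hG, hq⟩
  have forget : ∀ {T : Set (Space l)}, MarkedIsoTo I R (Submodule.span ℝ {g}) l T →
      IsoTo I R l T := fun ⟨φ, hφ, _⟩ => ⟨φ, hφ⟩
  rcases hR.markedIsoTo hred hG hq with h | h | h | h | h | ⟨-, h⟩
  · exact Or.inl (exists_reduced_marking hR (forget h))
  · exact Or.inr (Or.inl (forget h))
  · exact Or.inl (exists_reduced_marking hR (forget h))
  · exact Or.inr (Or.inr (forget h))
  · exact Or.inl (exists_reduced_marking hR (forget h))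
  · exact Or.inl (exists_reduced_marking hR (forget h))
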